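/- For a real number $\alpha$, an integer $a\ge 0$ and $\epsilon\ge 0$, a unitary $U$ on $a+n$ qubits is an $(\alpha,a,\epsilon)$-block-encoding of an $n$-qubit operator $A$ if $\|A-\alpha(\langle 0^a|\otimes I)U(|0^a\rangle\otimes I)\|\le\epsilon$ in operator norm. A primitive gate is an arbitrary one- or two-qubit unitary. **Corollary.** For every $\epsilon_0\in(0,1)$ there is a constant $C>0$, depending only on $\epsilon_0$, such that the following holds. Let $n,m\ge 0$ be integers, $\alpha>0$, $\Delta>0$, $\lambda,\theta\in\mathbb{R}$ and $0<\epsilon\le\epsilon_0$. Then there is a quantum circuit on $m+3$ ancilla qubits and $n$ main qubits, with calls to a black-box unitary on $m+n$ qubits, that consists of at most $C\,(\alpha/\Delta)\log(1/\epsilon)$ applications of the (possibly controlled) black box or its adjoint and at most $C\,((m+1)\alpha/\Delta)\log(1/\epsilon)$ primitive gates, and that has the following property. Let $H$ be any Hermitian operator on $n$ qubits, $U_H$ any $(\alpha,m,0)$-block-encoding of $H$, and suppose that $\lambda$ is an eigenvalue of $H$ with $|\mu-\lambda|\ge\Delta$ for every other eigenvalue $\mu$ of $H$. Then the circuit, with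 $U_H$ as the black box, implements a $(1,m+3,\epsilon)$-block-encoding of the $\theta$-reflection $$P_\lambda+e^{i\theta}(I-P_\lambda),$$ where $P_\lambda$ is the orthogonal projection onto the $\lambda$-eigenspace of $H$. -/

import Mathlib

/-! Operators on a finite set `W` of qubits are matrices indexed by `W → Fin 2`, the computational
basis states. -/

namespace Quantum

noncomputable section

/-- Matrices acting on the qubits in `W`. -/
abbrev QubitOp (W : Type) : Type := Matrix (W → Fin 2) (W → Fin 2) ℂ

/-- The operator norm induced by the Euclidean norm on state vectors. -/
def opNorm {ι : Type} [Fintype ι] [DecidableEq ι] (A : Matrix ι ι ℂ) : ℝ :=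
  ‖Matrix.toEuclideanCLM (n := ι) (𝕜 := ℂ) A‖

/-- `(⟨0^a| ⊗ I) U (|0^a⟩ ⊗ I)`, where the first `a` qubits are the ancillas. -/
def ancillaBlock {a n : ℕ} (U : QubitOp (Fin a ⊕ Fin n)) : QubitOp (Fin n) :=
  fun x y => U (Sum.elim (fun _ => 0) x) (Sum.elim (fun _ => 0) y)

/-- `U` is an `(α, a, ε)`-block-encoding of the `n`-qubit operator `A`. -/
def IsBlockEncoding {n : ℕ} (α : ℝ) (a : ℕ) (ε : ℝ) (U : QubitOp (Fin a ⊕ Fin n))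
    (A : QubitOp (Fin n)) : Prop :=
  U ∈ Matrix.unitaryGroup (Fin a ⊕ Fin n → Fin 2) ℂ ∧
    opNorm (A - (α : ℂ) • ancillaBlock U) ≤ ε

/-- The orthogonal projection onto the `lam`-eigenspace of `H`, as a matrix. -/
def eigenProjection {ι : Type} [Fintype ι] [DecidableEq ι] (H : Matrix ι ι ℂ) (lam : ℝ) :
    Matrix ι ι ℂ :=
  (Matrix.toEuclideanCLM (n := ι) (𝕜 := ℂ)).symm
    (Module.End.eigenspace (Matrix.toEuclideanLin H) (lam : ℂ)).starProjection

/-- `lam` is an eigenvalue of `H`, at distance at least `gap` from all other points of the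
spectrum. -/
def IsGappedEigenvalue {ι : Type} [Fintype ι] [DecidableEq ι] (H : Matrix ι ι ℂ)
    (lam gap : ℝ) : Prop :=
  Module.End.HasEigenvalue (Matrix.toEuclideanLin H) (lam : ℂ) ∧
    ∀ μ ∈ spectrum ℂ H, μ ≠ (lam : ℂ) → gap ≤ ‖μ - (lam : ℂ)‖

/-- The operator on the wires `W` that applies `U` to the wires `e q`, `q : Q`, and the identity
to all other wires. -/
def applyOn {Q W : Type} [Fintype Q] [Fintype W] [DecidableEq W]
    (e : Q ↪ W) (U : QubitOp Q) : QubitOp W :=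
  fun x y => if ∀ w, (∀ q, e q ≠ w) → x w = y w then U (x ∘ e) (y ∘ e) else 0

/-- Controlled `U`, namely `|0⟩⟨0| ⊗ I + |1⟩⟨1| ⊗ U`; the control qubit is `none`. -/
def controlled {Q : Type} [Fintype Q] [DecidableEq Q] (U : QubitOp Q) : QubitOp (Option Q) :=
  fun x y =>
    if x none = y none then
      if x none = 1 then U (x ∘ some) (y ∘ some)
      else (1 : QubitOp Q) (x ∘ some) (y ∘ some)
    else 0

/-- Gates of a circuit on the wires `W` with access to a black-box unitary on the qubits `Q`. -/
inductive Gate (Q W : Type) : Type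
  /-- A primitive gate: any one- or two-qubit unitary, on distinct wires. -/
  | primitive (k : ℕ) (hk : k = 1 ∨ k = 2) (e : Fin k ↪ W)
      (g : Matrix.unitaryGroup (Fin k → Fin 2) ℂ) : Gate Q W
  /-- The black box, or its adjoint if `adj` is true. -/
  | query (adj : Bool) (e : Q ↪ W) : Gate Q W
  /-- The controlled black box, or the controlled adjoint; the control wire is `e none`. -/
  | controlledQuery (adj : Bool) (e : Option Q ↪ W) : Gate Q W

namespace Gate

/-- The operator of a gate when the black box is `U`. -/
def eval {Q W : Type} [Fintype Q] [DecidableEq Q] [Fintype W] [DecidableEq W]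
    (U : QubitOp Q) : Gate Q W → QubitOp W
  | primitive _ _ e g => applyOn e (g : Matrix _ _ ℂ)
  | query adj e => applyOn e (if adj then U.conjTranspose else U)
  | controlledQuery adj e => applyOn e (controlled (if adj then U.conjTranspose else U))

/-- Whether a gate is an application of the (controlled) black box or its adjoint. -/
def isQuery {Q W : Type} : Gate Q W → Bool
  | primitive _ _ _ _ => false
  | query _ _ => true
  | controlledQuery _ _ => true

end Gate

/-- A circuit: a list of gates in the order in which they are applied. The gates are fixed
independently of the black box. -/
abbrev Circuit (Q W : Type) : Type := List (Gate Q W)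

namespace Circuit

/-- The operator that a circuit implements when the black box is `U`. -/
def eval {Q W : Type} [Fintype Q] [DecidableEq Q] [Fintype W] [DecidableEq W]
    (U : QubitOp Q) : Circuit Q W → QubitOp W
  | [] => 1
  | g :: c => eval U c * g.eval U

/-- The number of applications of the (controlled) black box and its adjoint. -/
def queryCount {Q W : Type} (c : Circuit Q W) : ℕ := c.countP (fun g => g.isQuery)

/-- The number of primitive gates. -/
def primitiveCount {Q W : Type} (c : Circuit Q W) : ℕ := c.countP (fun g => !g.isQuery)

end Circuit

end

end Quantum

/-! Put A = (H - λ)/β with β = α + |λ|. Every eigenvalue of H is at most α in modulus, so the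
spectrum of A lies in [-1, 1]; λ becomes 0, and since |λ| ≤ α, the other eigenvalues of A have
modulus at least Δ/(2α). The reflection is thus close to f(4A²) for any polynomial f that is near 1
at 0 and near e = exp(iθ) at 4x² for those other x. The choice is f = (1 - ε/2)(e + (1 - e)g), where
g is an even power of a normalised Dirichlet kernel; its degree bound d is O((α/Δ) log(1/ε))
(`filterPoly`, `reflectionPoly`, `degree_bound`).

To implement f(4A²), one controlled query between two rotations of an extra qubit gives a unitary V
whose ancilla block is A (`ancillaBlock_shiftCircuit`). With Z the reflection that negates the zero
state of the ancillas, the walk W = -V†ZVZ satisfies 2 - W - W† = 4A² on states whose ancillas are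
all zero (`walkOp_mulVec_embedZero`). Hence f(4A²) = W⁻ᵈ P(W) there, where P(z) = zᵈ f(2 - z - 1/z)
is an ordinary polynomial of degree at most 2d with modulus below 1 on the unit circle.

By the Fejér–Riesz theorem there is a Q with |P|² + |Q|² = 1 on the circle (`exists_complement`).
Such a pair factors into 2d + 1 rotations of a signal qubit alternating with diag(1, z)
(`exists_rotations`), and substituting the controlled W for diag(1, z) implements P(W)
(`ControlsOperator.act_interleave`). The factor W⁻ᵈ is then applied on the branch where the signal
qubit is 0 (`ControlsOperator.act_undo`).

Controlling W requires only its two reflections to be controlled, since V†V = 1. Each is a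
multi-controlled NOT between Hadamards, of size linear in m with one borrowed wire
(`permutes_multiNot`). The three extra ancillas are the signal wire, the wire of the linear
combination and the borrowed wire. If Δ > 2α, no other eigenvalue fits into [-α, α], and the empty
circuit suffices. -/

namespace Quantum

noncomputable section

open Polynomial ComplexConjugate

/-! ### Reciprocal polynomials and the Fejér–Riesz theorem -/

/-- The reciprocal polynomial `X ^ N * conj p (1 / X)`. -/
def conjReflect (N : ℕ) (p : ℂ[X]) : ℂ[X] := reflect N (p.map (starRingEnd ℂ))

lemma eval_conjReflect {N : ℕ} {p : ℂ[X]} (hp : p.natDegree ≤ N) {z : ℂ} (hz : z ≠ 0) :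
    (conjReflect N p).eval z = z ^ N * conj (p.eval (conj z)⁻¹) := by
  have : Invertible (z⁻¹) := invertibleOfNonzero (inv_ne_zero hz)
  have h := eval₂_reflect_mul_pow (RingHom.id ℂ) z⁻¹ N (p.map (starRingEnd ℂ))
    (natDegree_map_le.trans hp)
  simp only [invOf_eq_inv, inv_inv] at h
  have h2 : eval z⁻¹ (p.map (starRingEnd ℂ)) = conj (p.eval (conj z)⁻¹) := by
    have : z⁻¹ = conj ((conj z)⁻¹) := by simp
    rw [this, eval_map, eval₂_hom]
  rw [← h2]
  change eval z (reflect N _) * _ = eval z⁻¹ _ at h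
  rw [← h, conjReflect, inv_pow]
  have := pow_ne_zero N hz
  field_simp

lemma inv_conj_of_norm_eq_one {z : ℂ} (hz : ‖z‖ = 1) : (conj z)⁻¹ = z := by
  have : z * conj z = 1 := by rw [Complex.mul_conj']; simp [hz]
  exact (eq_inv_of_mul_eq_one_left this).symm

lemma ne_zero_of_norm_eq_one {z : ℂ} (hz : ‖z‖ = 1) : z ≠ 0 := by
  rintro rfl; simp at hz

/-- The circle is fixed by z ↦ 1/conj z. Consequently p times its reciprocal equals zᴺ|p|² there,
which makes squared moduli accessible to polynomial algebra. -/
lemma eval_conjReflect_of_norm_eq_one {N : ℕ} {p : ℂ[X]} (hp : p.natDegree ≤ N) {z : ℂ}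
    (hz : ‖z‖ = 1) : (conjReflect N p).eval z = z ^ N * conj (p.eval z) := by
  rw [eval_conjReflect hp (ne_zero_of_norm_eq_one hz), inv_conj_of_norm_eq_one hz]

lemma natDegree_conjReflect_le {N : ℕ} {p : ℂ[X]} (hp : p.natDegree ≤ N) :
    (conjReflect N p).natDegree ≤ N :=
  natDegree_reflect_le.trans (max_le le_rfl (natDegree_map_le.trans hp))

lemma infinite_unit_circle : {z : ℂ | ‖z‖ = 1}.Infinite := by
  refine Set.infinite_of_injective_forall_mem (f := fun n : ℕ => Complex.exp ((1 / (n + 1 : ℝ) : ℝ) * Complex.I))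
    ?_ (fun n => ?_)
  · intro a b hab
    have h : ∀ n : ℕ, Complex.arg (Complex.exp ((1 / (n + 1 : ℝ) : ℝ) * Complex.I)) = 1 / (n + 1 : ℝ) := by
      intro n
      have h1 : (0 : ℝ) < 1 / (n + 1 : ℝ) := by positivity
      have h2 : 1 / (n + 1 : ℝ) ≤ 1 := by
        rw [div_le_one (by positivity)]
        linarith [(Nat.cast_nonneg n : (0 : ℝ) ≤ n)]
      rw [Complex.arg_exp_mul_I, toIocMod_eq_self]
      constructor <;> linarith [Real.pi_gt_three]
    have := congrArg Complex.arg hab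
    simp only [h] at this
    have h1 : ((a : ℝ) + 1) = b + 1 := by
      rwa [div_eq_div_iff (by positivity) (by positivity), one_mul, one_mul, eq_comm] at this
    exact_mod_cast (add_right_cancel h1)
  · exact Complex.norm_exp_ofReal_mul_I _

lemma eq_of_eval_eq_on_circle {p q : ℂ[X]} (h : ∀ z : ℂ, ‖z‖ = 1 → p.eval z = q.eval z) :
    p = q :=
  eq_of_infinite_eval_eq p q (infinite_unit_circle.mono fun z hz => h z hz)

/-- Fejér-Riesz: a positive trigonometric polynomial is the squared modulus of a polynomial. -/
theorem fejer_riesz (d : ℕ) : ∀ g : ℂ[X], g.natDegree ≤ 2 * d →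
    (∀ z : ℂ, ‖z‖ = 1 → ∃ r : ℝ, 0 < r ∧ g.eval z = z ^ d * r) →
    ∃ q : ℂ[X], q.natDegree ≤ d ∧
      ∀ z : ℂ, ‖z‖ = 1 → g.eval z = z ^ d * ((‖q.eval z‖ ^ 2 : ℝ) : ℂ) := by
  induction d with
  | zero =>
    intro g hg hr
    obtain ⟨c, rfl⟩ := natDegree_eq_zero.mp (Nat.le_zero.mp hg)
    obtain ⟨r, hr0, hr1⟩ := hr 1 (by simp)
    refine ⟨C (Real.sqrt r : ℂ), by simp, fun z _ => ?_⟩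
    simp only [eval_C, pow_zero, one_mul] at hr1 ⊢
    rw [hr1, Complex.norm_real, Real.norm_eq_abs, sq_abs, Real.sq_sqrt hr0.le]
  | succ d ih =>
    intro g hg hr
    -- Since z⁻⁽ᵈ⁺¹⁾g is real on the circle, g is its own reciprocal: coefficients are
    -- conjugate-symmetric and nonzero roots come in pairs a, 1/conj a.
    have hself : conjReflect (2 * (d + 1)) g = g := by
      refine eq_of_eval_eq_on_circle fun z hz => ?_
      obtain ⟨r, -, h⟩ := hr z hz
      rw [eval_conjReflect_of_norm_eq_one hg hz, h, map_mul, map_pow, Complex.conj_ofReal, ← mul_assoc,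
        two_mul, pow_add, mul_assoc (z ^ (d + 1)), ← mul_pow, Complex.mul_conj', hz]
      simp
    -- If the constant coefficient vanishes, so does the top one by symmetry; dividing by X lowers
    -- the degree bound by two.
    by_cases h0 : g.coeff 0 = 0
    · obtain ⟨h, rfl⟩ : X ∣ g := X_dvd_iff.mpr h0
      have htop : (X * h : ℂ[X]).coeff (2 * (d + 1)) = 0 := by
        rw [← hself, conjReflect, coeff_reflect, revAt_le le_rfl, Nat.sub_self, coeff_map, h0,
          map_zero]
      have hdeg : h.natDegree ≤ 2 * d := by
        rw [natDegree_le_iff_coeff_eq_zero]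
        intro N hN
        rw [← coeff_X_mul]
        rcases Nat.lt_or_ge (2 * (d + 1)) (N + 1) with h1 | h1
        · exact coeff_eq_zero_of_natDegree_lt (lt_of_le_of_lt hg h1)
        · rw [show N + 1 = 2 * (d + 1) by omega]; exact htop
      obtain ⟨q, hq, hq'⟩ := ih h hdeg fun z hz => by
        obtain ⟨r, hr0, h1⟩ := hr z hz
        refine ⟨r, hr0, mul_left_cancel₀ (ne_zero_of_norm_eq_one hz) ?_⟩
        rw [eval_mul, eval_X] at h1
        rw [h1]; ring
      refine ⟨q, by omega, fun z hz => ?_⟩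
      rw [eval_mul, eval_X, hq' z hz]; ring
    · have hnd : g.degree ≠ 0 := by
        intro hdeg
        have htop : g.coeff (2 * (d + 1)) = conj (g.coeff 0) := by
          conv_lhs => rw [← hself]
          rw [conjReflect, coeff_reflect, revAt_le le_rfl, Nat.sub_self, coeff_map]
        have h1 : g.coeff (2 * (d + 1)) = 0 :=
          coeff_eq_zero_of_degree_lt (by rw [hdeg]; exact_mod_cast (by omega : 0 < 2 * (d + 1)))
        rw [h1] at htop
        exact h0 (by simpa using htop.symm)
      obtain ⟨a, ha⟩ := IsAlgClosed.exists_root g hnd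
      have ha0 : a ≠ 0 := by
        rintro rfl
        exact h0 (by rw [coeff_zero_eq_eval_zero]; exact ha)
      -- Strict positivity keeps roots off the circle, so a and 1/conj a are distinct and no
      -- discussion of multiplicities is needed.
      have ha1 : ‖a‖ ≠ 1 := by
        intro h1
        obtain ⟨r, hr0, h⟩ := hr a h1
        rw [ha.eq_zero] at h
        exact (mul_ne_zero (pow_ne_zero _ ha0) (by exact_mod_cast hr0.ne')) h.symm
      have hca0 : conj a ≠ 0 := by simpa using ha0
      have hb : g.IsRoot (conj a)⁻¹ := by
        have h := eval_conjReflect hg (z := (conj a)⁻¹) (inv_ne_zero hca0)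
        rw [hself] at h
        rw [IsRoot, h]
        simp [ha.eq_zero]
      have hab : a ≠ (conj a)⁻¹ := by
        intro h
        have h2 : a * conj a = 1 := by
          nth_rewrite 1 [h]; exact inv_mul_cancel₀ hca0
        rw [Complex.mul_conj'] at h2
        have h3 : ‖a‖ ^ 2 = 1 := by exact_mod_cast h2
        exact ha1 ((pow_eq_one_iff_of_nonneg (norm_nonneg a) two_ne_zero).mp h3)
      obtain ⟨h, rfl⟩ : (X - C a) * (X - C (conj a)⁻¹) ∣ g :=
        (pairwise_coprime_X_sub_C (s := (id : ℂ → ℂ)) Function.injective_id hab).mul_dvd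
          (dvd_iff_isRoot.mpr ha) (dvd_iff_isRoot.mpr hb)
      have hne : h ≠ 0 := by rintro rfl; simp at h0
      have hm : ((X - C a) * (X - C (conj a)⁻¹) : ℂ[X]).Monic :=
        (monic_X_sub_C _).mul (monic_X_sub_C _)
      have hdeg : h.natDegree ≤ 2 * d := by
        rw [hm.natDegree_mul' hne, (monic_X_sub_C _).natDegree_mul (monic_X_sub_C _),
          natDegree_X_sub_C, natDegree_X_sub_C] at hg
        omega
      -- On the circle the paired linear factors equal |z - a|² times z and a constant. Moving that
      -- constant into the cofactor leaves a positive trigonometric polynomial of smaller degree.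
      have key : ∀ z : ℂ, ‖z‖ = 1 →
          (z - a) * (z - (conj a)⁻¹) = -(conj a)⁻¹ * z * ((‖z - a‖ ^ 2 : ℝ) : ℂ) := by
        intro z hz
        have hz1 : z * conj z = 1 := by rw [Complex.mul_conj']; simp [hz]
        rw [Complex.ofReal_pow, ← Complex.mul_conj', map_sub]
        have : -(conj a)⁻¹ * z * ((z - a) * (conj z - conj a)) =
          (z - a) * (-(conj a)⁻¹ * (z * conj z) + (conj a)⁻¹ * conj a * z) := by ring
        rw [this, hz1, inv_mul_cancel₀ hca0]; ring
      have hza : ∀ z : ℂ, ‖z‖ = 1 → z - a ≠ 0 := by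
        intro z hz h
        rw [sub_eq_zero] at h
        exact ha1 (h ▸ hz)
      obtain ⟨q, hq, hq'⟩ := ih (C (-(conj a)⁻¹) * h)
        ((natDegree_C_mul_le _ _).trans hdeg) fun z hz => by
          obtain ⟨r, hr0, h1⟩ := hr z hz
          have hpos : 0 < ‖z - a‖ ^ 2 := by have := norm_pos_iff.mpr (hza z hz); positivity
          refine ⟨r / ‖z - a‖ ^ 2, by positivity, ?_⟩
          simp only [eval_mul, eval_sub, eval_X, eval_C] at h1 ⊢
          rw [key z hz] at h1
          rw [Complex.ofReal_div]
          have hne' : ((‖z - a‖ ^ 2 : ℝ) : ℂ) ≠ 0 := by exact_mod_cast hpos.ne'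
          rw [← mul_div_assoc, eq_div_iff hne']
          refine mul_left_cancel₀ (ne_zero_of_norm_eq_one hz) ?_
          rw [show z * (z ^ d * (r : ℂ)) = z ^ (d + 1) * r by ring, ← h1]; ring
      refine ⟨(X - C a) * q, ?_, fun z hz => ?_⟩
      · refine natDegree_mul_le.trans ?_
        rw [natDegree_X_sub_C]; omega
      · have h2 := hq' z hz
        simp only [eval_mul, eval_sub, eval_X, eval_C] at h2 ⊢
        rw [key z hz, norm_mul, mul_pow, Complex.ofReal_mul, show -(conj a)⁻¹ * z * ((‖z - a‖ ^ 2 : ℝ) : ℂ) * eval z h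
          = z * ((‖z - a‖ ^ 2 : ℝ) : ℂ) * (-(conj a)⁻¹ * eval z h) by ring, h2]
        ring

/-- The completion of a contractive polynomial to a unit vector of polynomials. -/
theorem exists_complement {D : ℕ} {p : ℂ[X]} (hp : p.natDegree ≤ D)
    (h : ∀ z : ℂ, ‖z‖ = 1 → ‖p.eval z‖ < 1) :
    ∃ q : ℂ[X], q.natDegree ≤ D ∧ ∀ z : ℂ, ‖z‖ = 1 → ‖p.eval z‖ ^ 2 + ‖q.eval z‖ ^ 2 = 1 := by
  -- The polynomial fed to Fejér–Riesz is zᴰ(1 - |p|²), written with the reciprocal of p.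
  have hev : ∀ z : ℂ, ‖z‖ = 1 →
      (X ^ D - p * conjReflect D p).eval z = z ^ D * ((1 - ‖p.eval z‖ ^ 2 : ℝ) : ℂ) := by
    intro z hz
    rw [eval_sub, eval_mul, eval_pow, eval_X, eval_conjReflect_of_norm_eq_one hp hz]
    push_cast
    rw [← Complex.mul_conj']; ring
  obtain ⟨q, hq, hq'⟩ := fejer_riesz D (X ^ D - p * conjReflect D p)
    (by
      refine (natDegree_sub_le _ _).trans (max_le ?_ ?_)
      · rw [natDegree_X_pow]; omega
      · refine natDegree_mul_le.trans ?_
        have := natDegree_conjReflect_le hp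
        omega)
    fun z hz => ⟨1 - ‖p.eval z‖ ^ 2, by nlinarith [h z hz, norm_nonneg (p.eval z)], hev z hz⟩
  refine ⟨q, hq, fun z hz => ?_⟩
  have h1 := (hev z hz).symm.trans (hq' z hz)
  have h2 := mul_left_cancel₀ (pow_ne_zero D (ne_zero_of_norm_eq_one hz)) h1
  have h3 : 1 - ‖p.eval z‖ ^ 2 = ‖q.eval z‖ ^ 2 := by exact_mod_cast h2
  linarith

end

end Quantum

namespace Quantum

noncomputable section

open Polynomial ComplexConjugate

/-! ### Factoring a unit pair of polynomials into rotations -/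

/-- The special unitary matrix with first column `(u, v)`. -/
def columnUnitary (u v : ℂ) : Matrix (Fin 2) (Fin 2) ℂ := !![u, -conj v; v, conj u]

lemma columnUnitary_mem {u v : ℂ} (h : ‖u‖ ^ 2 + ‖v‖ ^ 2 = 1) :
    columnUnitary u v ∈ Matrix.unitaryGroup (Fin 2) ℂ := by
  have h' : u * conj u + v * conj v = 1 := by
    rw [Complex.mul_conj', Complex.mul_conj']; exact_mod_cast h
  rw [Matrix.mem_unitaryGroup_iff']
  ext i j
  fin_cases i <;> fin_cases j <;>
    simp [columnUnitary, Matrix.mul_apply, Matrix.star_apply, Fin.sum_univ_two] <;>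
    first | linear_combination h' | ring

/-- The pair of polynomials generated by a sequence of rotations interleaved with
`diag(1, X)`. -/
def rotationPair : List (Matrix.unitaryGroup (Fin 2) ℂ) → ℂ[X] × ℂ[X]
  | [] => (1, 0)
  | r :: l =>
    (C (r.1 0 0) * (rotationPair l).1 + C (r.1 0 1) * (X * (rotationPair l).2),
      C (r.1 1 0) * (rotationPair l).1 + C (r.1 1 1) * (X * (rotationPair l).2))

/-- A unit vector of complex numbers which is annihilated by two orthogonal functionals. -/
lemma exists_unit_annihilating (p q s t : ℂ) (h : s * conj p + t * conj q = 0) :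
    ∃ u v : ℂ, ‖u‖ ^ 2 + ‖v‖ ^ 2 = 1 ∧ conj u * p + conj v * q = 0 ∧ -v * s + u * t = 0 := by
  have norm_case : ∀ a b : ℂ, (a ≠ 0 ∨ b ≠ 0) → conj a * p + conj b * q = 0 →
      -b * s + a * t = 0 →
      ∃ u v : ℂ, ‖u‖ ^ 2 + ‖v‖ ^ 2 = 1 ∧ conj u * p + conj v * q = 0 ∧ -v * s + u * t = 0 := by
    intro a b hab h1 h2
    have hpos : 0 < ‖a‖ ^ 2 + ‖b‖ ^ 2 := by
      rcases hab with hab | hab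
      · have := norm_pos_iff.mpr hab; positivity
      · have := norm_pos_iff.mpr hab; positivity
    set c : ℝ := Real.sqrt (‖a‖ ^ 2 + ‖b‖ ^ 2) with hc
    have hc0 : 0 < c := Real.sqrt_pos.mpr hpos
    have hc2 : c ^ 2 = ‖a‖ ^ 2 + ‖b‖ ^ 2 := Real.sq_sqrt hpos.le
    have hcc : (c : ℂ) ≠ 0 := by exact_mod_cast hc0.ne'
    refine ⟨a / c, b / c, ?_, ?_, ?_⟩
    · rw [norm_div, norm_div, Complex.norm_real, Real.norm_of_nonneg hc0.le, div_pow, div_pow,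
        ← add_div, ← hc2, div_self (by positivity)]
    · rw [map_div₀, map_div₀, Complex.conj_ofReal]
      field_simp
      rw [h1, mul_zero]
    · field_simp
      linear_combination h2
  -- The conditions ask that (u, v) be orthogonal to (p, q) and parallel to (s, t), and the
  -- hypothesis says that (s, t) is orthogonal to (p, q). So normalise (s, t) if it is nonzero, and
  -- otherwise any nonzero vector orthogonal to (p, q).
  by_cases hst : s = 0 ∧ t = 0
  · obtain ⟨rfl, rfl⟩ := hst
    by_cases hpq : p = 0 ∧ q = 0
    · obtain ⟨rfl, rfl⟩ := hpq
      exact ⟨1, 0, by simp, by simp, by simp⟩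
    · refine norm_case (-conj q) (conj p) ?_ (by simp; ring) (by simp)
      by_contra! hcon
      exact hpq ⟨by simpa using hcon.2, by simpa using hcon.1⟩
  · refine norm_case s t (by tauto) ?_ (by ring)
    have := congrArg conj h
    simpa using this

lemma natDegree_le_of_coeff_succ_eq_zero {D : ℕ} {p : ℂ[X]} (h : p.natDegree ≤ D + 1)
    (h0 : p.coeff (D + 1) = 0) : p.natDegree ≤ D := by
  rw [natDegree_le_iff_coeff_eq_zero]
  intro N hN
  rcases Nat.lt_or_ge (D + 1) N with h1 | h1
  · exact coeff_eq_zero_of_natDegree_lt (lt_of_le_of_lt h h1)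
  · rwa [show N = D + 1 by omega]

/-- Every pair of polynomials that is a unit vector on the circle is generated by rotations. -/
theorem exists_rotations (D : ℕ) : ∀ P Q : ℂ[X], P.natDegree ≤ D → Q.natDegree ≤ D →
    (∀ z : ℂ, ‖z‖ = 1 → ‖P.eval z‖ ^ 2 + ‖Q.eval z‖ ^ 2 = 1) →
    ∃ l : List (Matrix.unitaryGroup (Fin 2) ℂ), l.length = D + 1 ∧ rotationPair l = (P, Q) := by
  induction D with
  | zero =>
    intro P Q hP hQ h
    obtain ⟨u, rfl⟩ := natDegree_eq_zero.mp (Nat.le_zero.mp hP)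
    obtain ⟨v, rfl⟩ := natDegree_eq_zero.mp (Nat.le_zero.mp hQ)
    refine ⟨[⟨columnUnitary u v, columnUnitary_mem (by simpa using h 1 (by simp))⟩], rfl, ?_⟩
    simp [rotationPair, columnUnitary]
  | succ D ih =>
    intro P Q hP hQ h
    have hpoly : P * conjReflect (D + 1) P + Q * conjReflect (D + 1) Q = X ^ (D + 1) := by
      refine eq_of_eval_eq_on_circle fun z hz => ?_
      have h' : P.eval z * conj (P.eval z) + Q.eval z * conj (Q.eval z) = 1 := by
        rw [Complex.mul_conj', Complex.mul_conj']; exact_mod_cast h z hz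
      simp only [eval_add, eval_mul, eval_pow, eval_X, eval_conjReflect_of_norm_eq_one hP hz,
        eval_conjReflect_of_norm_eq_one hQ hz]
      linear_combination z ^ (D + 1) * h'
    -- The constant coefficient of the unit-norm identity: the vectors of lowest and of highest
    -- coefficients are orthogonal. This is what lets a single rotation work at both ends.
    have hort : P.coeff 0 * conj (P.coeff (D + 1)) + Q.coeff 0 * conj (Q.coeff (D + 1)) = 0 := by
      have := congrArg (fun p => coeff p 0) hpoly
      simpa [mul_coeff_zero, conjReflect, coeff_reflect, coeff_X_pow] using this
    obtain ⟨u, v, huv, h1, h2⟩ := exists_unit_annihilating _ _ _ _ hort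
    have huv' : u * conj u + v * conj v = 1 := by
      rw [Complex.mul_conj', Complex.mul_conj']; exact_mod_cast huv
    have hC : C u * C (conj u) + C v * C (conj v) = (1 : ℂ[X]) := by
      rw [← C_mul, ← C_mul, ← C_add, huv', C_1]
    -- Undoing the outermost rotation: `P'` loses its top coefficient and `R` its constant one, so
    -- `P'` and `R / X` form a unit pair of degree at most D.
    set P' : ℂ[X] := C (conj u) * P + C (conj v) * Q with hP'
    set R : ℂ[X] := C (-v) * P + C u * Q with hR
    have hdegP : P'.natDegree ≤ D + 1 :=
      (natDegree_add_le _ _).trans (max_le ((natDegree_C_mul_le _ _).trans hP)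
        ((natDegree_C_mul_le _ _).trans hQ))
    have hdegR : R.natDegree ≤ D + 1 :=
      (natDegree_add_le _ _).trans (max_le ((natDegree_C_mul_le _ _).trans hP)
        ((natDegree_C_mul_le _ _).trans hQ))
    obtain ⟨Q', hQ'⟩ : X ∣ R := by
      rw [X_dvd_iff, hR]; simpa using h2
    have hdegQ' : Q'.natDegree ≤ D := by
      rcases eq_or_ne Q' 0 with h0 | h0
      · simp [h0]
      · rw [hQ', natDegree_X_mul h0] at hdegR; omega
    obtain ⟨l, hl, hl'⟩ := ih P' Q'
      (natDegree_le_of_coeff_succ_eq_zero hdegP (by rw [hP']; simpa using h1)) hdegQ'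
      (fun z hz => by
        have e1 := h z hz
        have e2 : ‖Q'.eval z‖ = ‖R.eval z‖ := by rw [hQ', eval_mul, eval_X, norm_mul, hz, one_mul]
        rw [e2]
        have e3 : P.eval z * conj (P.eval z) + Q.eval z * conj (Q.eval z) = 1 := by
          rw [Complex.mul_conj', Complex.mul_conj']; exact_mod_cast e1
        have e4 : P'.eval z * conj (P'.eval z) + R.eval z * conj (R.eval z) = 1 := by
          simp only [hP', hR, eval_add, eval_mul, eval_C, eval_neg, map_add, map_mul, map_neg,
            Complex.conj_conj]
          linear_combination (u * conj u + v * conj v) * e3 + huv'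
        rw [Complex.mul_conj', Complex.mul_conj'] at e4
        exact_mod_cast e4)
    refine ⟨⟨columnUnitary u v, columnUnitary_mem huv⟩ :: l, by simp [hl], ?_⟩
    rw [rotationPair, hl', ← hQ']
    simp only [columnUnitary, Matrix.of_apply, Matrix.cons_val', Matrix.cons_val_zero,
      Matrix.cons_val_one, Prod.mk.injEq, Matrix.cons_val_fin_one, hP', hR, C_neg]
    constructor
    · linear_combination P * hC
    · linear_combination Q * hC

/-! ### Polynomials in 2 - z - 1/z -/

/-- The homogenization of `f (2 - z - 1 / z)`, namely `z ^ d * f (2 - z - 1 / z)`. -/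
def laurentLift (d : ℕ) (f : ℂ[X]) : ℂ[X] :=
  ∑ i ∈ Finset.range (d + 1), C (f.coeff i) * ((-(1 - X) ^ 2) ^ i * X ^ (d - i))

lemma natDegree_laurentLift_le (d : ℕ) (f : ℂ[X]) : (laurentLift d f).natDegree ≤ 2 * d := by
  refine natDegree_sum_le_of_forall_le _ _ fun i hi => ?_
  have hi' : i ≤ d := by simpa [Nat.lt_succ_iff] using hi
  refine (natDegree_C_mul_le _ _).trans (natDegree_mul_le.trans ?_)
  have h1 : ((-(1 - X) ^ 2 : ℂ[X]) ^ i).natDegree ≤ i * 2 := by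
    refine natDegree_pow_le_of_le _ ?_
    rw [natDegree_neg]
    refine (natDegree_pow_le_of_le 2 (?_ : _ ≤ 1)).trans (by norm_num)
    exact (natDegree_sub_le _ _).trans (by simp)
  rw [natDegree_X_pow]
  omega

/-- `laurentLift` in an algebra, at an element with a right inverse. -/
lemma aeval_laurentLift {A : Type*} [Ring A] [Algebra ℂ A] {d : ℕ} {f : ℂ[X]}
    (hf : f.natDegree ≤ d) {w v : A} (h : w * v = 1) (h' : v * w = 1) :
    aeval w (laurentLift d f) = w ^ d * aeval (2 - w - v) f := by
  -- This identity distributes the d powers of w: i of them turn (2 - w - v)ⁱ into a polynomial in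
  -- w, and d - i remain.
  have hk : -(1 - w) ^ 2 = w * (2 - w - v) := by
    rw [mul_sub, mul_sub, h]; noncomm_ring
  have hcomm : Commute w (2 - w - v) := by
    have : Commute w v := by rw [Commute, SemiconjBy, h, h']
    refine Commute.sub_right (Commute.sub_right ?_ (Commute.refl w)) this
    exact (Nat.cast_commute 2 w).symm
  rw [laurentLift, map_sum, aeval_eq_sum_range' (Nat.lt_succ_of_le hf), Finset.mul_sum]
  refine Finset.sum_congr rfl fun i hi => ?_
  have hi' : i ≤ d := by simpa [Nat.lt_succ_iff] using hi
  simp only [map_mul, map_pow, map_neg, map_sub, map_one, aeval_X, aeval_C]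
  rw [hk, hcomm.mul_pow, mul_smul_comm, Algebra.smul_def]
  congr 1
  rw [(hcomm.pow_pow i i).eq, mul_assoc, ← pow_add, Nat.add_sub_cancel' hi',
    (hcomm.pow_pow d i).eq]

/-! ### The filter polynomial -/

/-- The Dirichlet kernel of degree `M`, as a polynomial in `2 - z - 1 / z`. -/
def dirichletPoly : ℕ → ℝ[X]
  | 0 => 1
  | 1 => 3 - X
  | M + 2 => (2 - X) * dirichletPoly (M + 1) - dirichletPoly M

lemma natDegree_dirichletPoly_le (M : ℕ) : (dirichletPoly M).natDegree ≤ M := by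
  have hlin : ∀ c : ℝ, (C c - X : ℝ[X]).natDegree ≤ 1 := fun c =>
    (natDegree_sub_le _ _).trans (by simp)
  induction M using Nat.twoStepInduction with
  | zero => simp [dirichletPoly]
  | one => exact hlin 3
  | more M h0 h1 =>
    rw [dirichletPoly]
    refine (natDegree_sub_le _ _).trans (max_le (natDegree_mul_le.trans ?_) (by omega))
    have := hlin 2
    change (2 - X : ℝ[X]).natDegree ≤ 1 at this
    omega

lemma eval_dirichletPoly_zero (M : ℕ) : (dirichletPoly M).eval 0 = 2 * M + 1 := by
  induction M using Nat.twoStepInduction with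
  | zero => simp [dirichletPoly]
  | one => simp [dirichletPoly]; norm_num
  | more M h0 h1 =>
    simp only [dirichletPoly, eval_sub, eval_mul, h0, h1, eval_X, eval_ofNat]
    push_cast; ring

/-- With φ = (2M + 3)u, the recurrence is sin(φ + 2u) + sin(φ - 2u) = 2 cos(2u) sin φ, where 2
cos(2u) = 2 - 4 sin²u. -/
lemma eval_dirichletPoly_mul_sin (M : ℕ) (u : ℝ) :
    (dirichletPoly M).eval (4 * Real.sin u ^ 2) * Real.sin u = Real.sin ((2 * M + 1) * u) := by
  induction M using Nat.twoStepInduction with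
  | zero => simp [dirichletPoly]
  | one =>
    simp only [dirichletPoly, eval_sub, eval_X, eval_ofNat]
    rw [show (2 * ((1 : ℕ) : ℝ) + 1) * u = 3 * u by push_cast; ring, Real.sin_three_mul]
    ring
  | more M h0 h1 =>
    simp only [dirichletPoly, eval_sub, eval_mul, eval_X, eval_ofNat]
    rw [sub_mul, mul_assoc, h1, h0]
    have e1 : (2 * ((M + 1 : ℕ) : ℝ) + 1) * u = (2 * M + 3) * u := by push_cast; ring
    have e2 : (2 * ((M + 2 : ℕ) : ℝ) + 1) * u = (2 * M + 3) * u + 2 * u := by push_cast; ring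
    have e3 : (2 * (M : ℝ) + 1) * u = (2 * M + 3) * u - 2 * u := by ring
    rw [e1, e2, e3, Real.sin_add, Real.sin_sub, Real.cos_two_mul, Real.cos_sq']
    ring

/-- Induction with the addition formula. It bounds the Dirichlet kernel by its value 2M + 1 at zero.
-/
lemma abs_sin_nat_mul_le (n : ℕ) (u : ℝ) : |Real.sin (n * u)| ≤ n * |Real.sin u| := by
  induction n with
  | zero => simp
  | succ n ih =>
    have : ((n + 1 : ℕ) : ℝ) * u = n * u + u := by push_cast; ring
    rw [this, Real.sin_add]
    refine (abs_add_le _ _).trans ?_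
    rw [abs_mul, abs_mul]
    have h1 := Real.abs_cos_le_one u
    have h2 := Real.abs_cos_le_one (n * u)
    push_cast
    nlinarith [abs_nonneg (Real.sin (n * u)), abs_nonneg (Real.sin u),
      abs_nonneg (Real.cos u), abs_nonneg (Real.cos (n * u))]

/-- The filter: it is `1` at `0` and small away from `0`. -/
def filterPoly (M k : ℕ) : ℝ[X] := (C (1 / (2 * M + 1 : ℝ)) * dirichletPoly M) ^ (2 * k)

lemma natDegree_filterPoly_le (M k : ℕ) : (filterPoly M k).natDegree ≤ 2 * k * M :=
  natDegree_pow_le_of_le _ ((natDegree_C_mul_le _ _).trans (natDegree_dirichletPoly_le M))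

lemma eval_filterPoly_zero (M k : ℕ) : (filterPoly M k).eval 0 = 1 := by
  rw [filterPoly, eval_pow, eval_mul, eval_C, eval_dirichletPoly_zero, one_div,
    inv_mul_cancel₀ (by positivity), one_pow]

lemma eval_filterPoly_nonneg (M k : ℕ) (t : ℝ) : 0 ≤ (filterPoly M k).eval t := by
  rw [filterPoly, eval_pow, pow_mul]; positivity

/-- Take u = arcsin x, so that the left side is |sin((2M + 1)u)|. Of the two bounds, 2M + 1 times
|x| gives contractivity and 1 gives decay away from zero. -/
lemma abs_eval_dirichletPoly_mul_le (M : ℕ) {x : ℝ} (hx : |x| ≤ 1) :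
    |(dirichletPoly M).eval (4 * x ^ 2)| * |x| ≤ min 1 ((2 * M + 1) * |x|) := by
  obtain ⟨h1, h2⟩ := abs_le.mp hx
  have h := eval_dirichletPoly_mul_sin M (Real.arcsin x)
  rw [Real.sin_arcsin h1 h2] at h
  rw [← abs_mul, h]
  refine le_min (Real.abs_sin_le_one _) ?_
  have := abs_sin_nat_mul_le (2 * M + 1) (Real.arcsin x)
  rw [Real.sin_arcsin h1 h2] at this
  exact_mod_cast this

lemma eval_filterPoly_le_one (M k : ℕ) {x : ℝ} (hx : |x| ≤ 1) :
    (filterPoly M k).eval (4 * x ^ 2) ≤ 1 := by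
  rcases eq_or_ne x 0 with rfl | h0
  · simp [eval_filterPoly_zero]
  · have h1 := (abs_eval_dirichletPoly_mul_le M hx).trans (min_le_right _ _)
    have h2 := le_of_mul_le_mul_right h1 (abs_pos.mpr h0)
    have hN : (0 : ℝ) < 2 * M + 1 := by positivity
    rw [filterPoly, eval_pow, pow_mul, eval_mul, eval_C, mul_pow, ← sq_abs (eval _ _)]
    refine pow_le_one₀ (by positivity) ?_
    rw [← mul_pow]
    refine pow_le_one₀ (by positivity) ?_
    rw [one_div, inv_mul_le_iff₀ hN, mul_one]
    exact h2

/-- Under the hypothesis on |x| the normalised kernel is at most 1/2 in modulus; its power 2k is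
then at most 4⁻ᵏ. -/
lemma eval_filterPoly_le (M k : ℕ) {x : ℝ} (hx : |x| ≤ 1) (h2 : 2 ≤ (2 * M + 1) * |x|) :
    (filterPoly M k).eval (4 * x ^ 2) ≤ (1 / 4) ^ k := by
  have hN : (0 : ℝ) < 2 * M + 1 := by positivity
  have h1 := (abs_eval_dirichletPoly_mul_le M hx).trans (min_le_left _ _)
  rw [filterPoly, eval_pow, pow_mul, eval_mul, eval_C, mul_pow, ← sq_abs (eval _ _), ← mul_pow]
  refine pow_le_pow_left₀ (by positivity) ?_ k
  have : 1 / (2 * (M : ℝ) + 1) * |eval (4 * x ^ 2) (dirichletPoly M)| ≤ 1 / 2 := by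
    rw [one_div, inv_mul_le_iff₀ hN]
    have hx0 : 0 < |x| := by
      by_contra hcon
      nlinarith [abs_nonneg x]
    refine le_of_mul_le_mul_right (h1.trans ?_) hx0
    linarith
  calc _ ≤ (1 / 2 : ℝ) ^ 2 := pow_le_pow_left₀ (by positivity) this 2
    _ = 1 / 4 := by norm_num

end

end Quantum

namespace Quantum

noncomputable section

open Matrix

/-! ### Operators placed on selected wires -/

lemma extend_comp_self {Q W : Type} (e : Q ↪ W) (z : Q → Fin 2) (x : W → Fin 2) :
    Function.extend e z x ∘ e = z :=
  funext fun q => e.injective.extend_apply z x q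

lemma extend_of_not_mem {Q W : Type} (e : Q ↪ W) (z : Q → Fin 2) (x : W → Fin 2) {w : W}
    (h : ∀ q, e q ≠ w) : Function.extend e z x w = x w :=
  Function.extend_apply' z x w fun ⟨q, hq⟩ => h q hq

lemma extend_extend {Q W : Type} (e : Q ↪ W) (z z' : Q → Fin 2) (x : W → Fin 2) :
    Function.extend e z' (Function.extend e z x) = Function.extend e z' x := by
  funext w
  by_cases h : ∃ q, e q = w
  · obtain ⟨q, rfl⟩ := h
    rw [e.injective.extend_apply, e.injective.extend_apply]
  · push Not at h
    rw [extend_of_not_mem e _ _ h, extend_of_not_mem e _ _ h, extend_of_not_mem e _ _ h]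

lemma eq_of_forall_mulVec {ι κ : Type} [Fintype κ] [DecidableEq κ] {A B : Matrix ι κ ℂ}
    (h : ∀ ψ, A *ᵥ ψ = B *ᵥ ψ) : A = B :=
  Matrix.mulVec_injective (funext h)

/-- `Function.extend e z x` overwrites the selected wires of `x` by `z`; these are exactly the basis
states that row `x` can reach. The sum over all wires therefore collapses to the gate's own wires,
and later circuit identities are checked in this form. -/
lemma applyOn_mulVec {Q W : Type} [Fintype Q] [DecidableEq Q] [Fintype W] [DecidableEq W] (e : Q ↪ W)
    (U : QubitOp Q) (ψ : (W → Fin 2) → ℂ) (x : W → Fin 2) :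
    (applyOn e U *ᵥ ψ) x = ∑ z, U (x ∘ e) z * ψ (Function.extend e z x) := by
  symm
  refine Fintype.sum_of_injective (fun z => Function.extend e z x) ?_ _ _ ?_ ?_
  · intro z z' h
    have := congrArg (· ∘ e) h
    simpa only [extend_comp_self] using this
  · intro y hy
    have hxy : applyOn e U x y = 0 := by
      rw [applyOn, if_neg]
      intro h
      refine hy ⟨y ∘ e, funext fun w => ?_⟩
      by_cases hw : ∃ q, e q = w
      · obtain ⟨q, rfl⟩ := hw
        exact e.injective.extend_apply _ _ _
      · push Not at hw
        exact (extend_of_not_mem e _ _ hw).trans (h w hw)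
    exact mul_eq_zero_of_left hxy _
  · intro z
    have hxz : applyOn e U x (Function.extend e z x) = U (x ∘ e) z := by
      rw [applyOn, if_pos, extend_comp_self]
      exact fun w hw => (extend_of_not_mem e _ _ hw).symm
    exact congrArg (· * _) hxz.symm

lemma applyOn_mul {Q W : Type} [Fintype Q] [DecidableEq Q] [Fintype W] [DecidableEq W] (e : Q ↪ W)
    (A B : QubitOp Q) : applyOn e (A * B) = applyOn e A * applyOn e B := by
  refine eq_of_forall_mulVec fun ψ => funext fun x => ?_
  rw [← mulVec_mulVec, applyOn_mulVec, applyOn_mulVec]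
  simp only [applyOn_mulVec, extend_comp_self, extend_extend, Matrix.mul_apply, Finset.sum_mul,
    Finset.mul_sum, mul_assoc]
  exact Finset.sum_comm

lemma applyOn_one {Q W : Type} [Fintype Q] [DecidableEq Q] [Fintype W] [DecidableEq W]
    (e : Q ↪ W) : applyOn e (1 : QubitOp Q) = 1 := by
  refine eq_of_forall_mulVec fun ψ => funext fun x => ?_
  rw [applyOn_mulVec, one_mulVec, Finset.sum_eq_single (x ∘ e)]
  · rw [Matrix.one_apply_eq, one_mul]
    congr 1
    funext w
    by_cases hw : ∃ q, e q = w
    · obtain ⟨q, rfl⟩ := hw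
      exact e.injective.extend_apply _ _ _
    · push Not at hw
      exact extend_of_not_mem e _ _ hw
  · intro z _ hz
    rw [Matrix.one_apply_ne hz.symm, zero_mul]
  · simp

lemma applyOn_conjTranspose {Q W : Type} [Fintype Q] [DecidableEq Q] [Fintype W] [DecidableEq W] (e : Q ↪ W)
    (A : QubitOp Q) : (applyOn e A)ᴴ = applyOn e Aᴴ := by
  ext x y
  simp only [conjTranspose_apply, applyOn, apply_ite star, star_zero, eq_comm]

lemma controlled_mulVec {Q : Type} [Fintype Q] [DecidableEq Q] (U : QubitOp Q)
    (ψ : (Option Q → Fin 2) → ℂ) (x : Option Q → Fin 2) :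
    (controlled U *ᵥ ψ) x =
      if x none = 1 then ∑ z, U (x ∘ some) z * ψ (Function.extend some z x) else ψ x := by
  have hinj : Function.Injective (fun z : Q → Fin 2 => Function.extend some z x) := by
    intro z z' h
    have := congrArg (· ∘ some) h
    simpa only [Function.extend_comp (Option.some_injective Q)] using this
  have hnone : ∀ z : Q → Fin 2, Function.extend some z x none = x none := fun z =>
    Function.extend_apply' _ _ _ (by simp)
  have hext : ∀ y : Option Q → Fin 2, x none = y none → Function.extend some (y ∘ some) x = y := by
    intro y hy
    funext w
    cases w with
    | none => rw [hnone, hy]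
    | some q => exact (Option.some_injective Q).extend_apply _ _ _
  split_ifs with h
  · symm
    refine Fintype.sum_of_injective _ hinj _ _ ?_ ?_
    · intro y hy
      have h' : x none ≠ y none := fun h' => hy ⟨y ∘ some, hext y h'⟩
      simp [controlled, h']
    · intro z
      simp only [controlled, hnone, if_true, h, Function.extend_comp (Option.some_injective Q)]
  · rw [mulVec, dotProduct, Finset.sum_eq_single x]
    · simp [controlled, h]
    · intro y _ hy
      simp only [controlled, h, if_false]
      split_ifs with h1
      · rw [Matrix.one_apply_ne, zero_mul]
        intro h2
        have := hext y h1
        rw [← h2, hext x rfl] at this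
        exact hy this.symm
      · rw [zero_mul]
    · simp

lemma controlled_mul {Q : Type} [Fintype Q] [DecidableEq Q] (A B : QubitOp Q) :
    controlled (A * B) = controlled A * controlled B := by
  refine eq_of_forall_mulVec fun ψ => funext fun x => ?_
  rw [← mulVec_mulVec, controlled_mulVec, controlled_mulVec]
  split_ifs with h
  · have hnone : ∀ z : Q → Fin 2, Function.extend some z x none = x none := fun z =>
      Function.extend_apply' _ _ _ (by simp)
    have hee : ∀ z z' : Q → Fin 2, Function.extend some z' (Function.extend some z x) =
        Function.extend some z' x := fun z z' => extend_extend Function.Embedding.some z z' x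
    simp only [controlled_mulVec, hnone, h, if_true, hee, Matrix.mul_apply, Finset.sum_mul,
      Finset.mul_sum, mul_assoc, Function.extend_comp (Option.some_injective Q)]
    exact Finset.sum_comm
  · rw [controlled_mulVec, if_neg h]

lemma controlled_one {Q : Type} [Fintype Q] [DecidableEq Q] :
    controlled (1 : QubitOp Q) = 1 := by
  ext x y
  simp only [controlled, ite_self, Matrix.one_apply, ← ite_and]
  congr 1
  refine propext ⟨fun h => funext fun w => ?_, ?_⟩
  · cases w with
    | none => exact h.1
    | some q => exact congrFun h.2 q
  · rintro rfl; exact ⟨rfl, rfl⟩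

lemma controlled_conjTranspose {Q : Type} [Fintype Q] [DecidableEq Q] (A : QubitOp Q) :
    (controlled A)ᴴ = controlled Aᴴ := by
  ext x y
  simp only [conjTranspose_apply, controlled]
  by_cases h : x none = y none
  · simp only [h, if_true]
    split_ifs
    · rfl
    · rw [← conjTranspose_apply, conjTranspose_one]
  · simp [h, Ne.symm h]

/-- Separates control from target: the branch is read off the control wire, and on the 1-branch the
uncontrolled operator acts on the remaining wires. -/
lemma applyOn_controlled_mulVec {Q W : Type} [Fintype Q] [DecidableEq Q] [Fintype W]
    [DecidableEq W] (e : Option Q ↪ W) (U : QubitOp Q) (ψ : (W → Fin 2) → ℂ) (x : W → Fin 2) :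
    (applyOn e (controlled U) *ᵥ ψ) x =
      if x (e none) = 1 then (applyOn (Function.Embedding.some.trans e) U *ᵥ ψ) x else ψ x := by
  rw [applyOn_mulVec]
  have := controlled_mulVec U (fun z => ψ (Function.extend e z x)) (x ∘ e)
  rw [mulVec, dotProduct] at this
  rw [this]
  simp only [Function.comp_apply]
  congr 1
  · rw [applyOn_mulVec]
    refine Finset.sum_congr rfl fun z _ => ?_
    congr 2
    funext w
    by_cases hw : ∃ q, e q = w
    · obtain ⟨q, rfl⟩ := hw
      rw [e.injective.extend_apply]
      cases q with
      | none =>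
        rw [Function.extend_apply' _ _ _ (by simp), extend_of_not_mem]
        · rfl
        · intro q h
          exact Option.some_ne_none q (e.injective h)
      | some q =>
        rw [(Option.some_injective Q).extend_apply]
        exact ((Function.Embedding.some.trans e).injective.extend_apply z x q).symm
    · push Not at hw
      rw [extend_of_not_mem _ _ _ hw, extend_of_not_mem]
      exact fun q => hw (some q)
  · congr 1
    funext w
    by_cases hw : ∃ q, e q = w
    · obtain ⟨q, rfl⟩ := hw
      exact e.injective.extend_apply _ _ _
    · push Not at hw
      exact extend_of_not_mem e _ _ hw

lemma applyOn_mem_unitaryGroup {Q W : Type} [Fintype Q] [DecidableEq Q] [Fintype W]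
    [DecidableEq W] (e : Q ↪ W) {U : QubitOp Q} (hU : U ∈ unitaryGroup (Q → Fin 2) ℂ) :
    applyOn e U ∈ unitaryGroup (W → Fin 2) ℂ := by
  rw [mem_unitaryGroup_iff, star_eq_conjTranspose, applyOn_conjTranspose, ← applyOn_mul,
    ← star_eq_conjTranspose, mem_unitaryGroup_iff.mp hU, applyOn_one]

lemma controlled_mem_unitaryGroup {Q : Type} [Fintype Q] [DecidableEq Q] {U : QubitOp Q}
    (hU : U ∈ unitaryGroup (Q → Fin 2) ℂ) :
    controlled U ∈ unitaryGroup (Option Q → Fin 2) ℂ := by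
  rw [mem_unitaryGroup_iff, star_eq_conjTranspose, controlled_conjTranspose, ← controlled_mul,
    ← star_eq_conjTranspose, mem_unitaryGroup_iff.mp hU, controlled_one]

lemma submatrix_mem_unitaryGroup {ι κ : Type} [Fintype ι] [DecidableEq ι] [Fintype κ]
    [DecidableEq κ] (σ : κ ≃ ι) {U : Matrix ι ι ℂ} (hU : U ∈ unitaryGroup ι ℂ) :
    U.submatrix σ σ ∈ unitaryGroup κ ℂ := by
  rw [mem_unitaryGroup_iff, star_eq_conjTranspose, conjTranspose_submatrix,
    submatrix_mul_equiv, ← star_eq_conjTranspose, mem_unitaryGroup_iff.mp hU,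
    submatrix_one_equiv]

/-! ### Adjoints, counts and the action of circuits -/

namespace Gate

/-- The inverse gate. -/
def adjoint {Q W : Type} : Gate Q W → Gate Q W
  | primitive k hk e g => primitive k hk e (star g)
  | query a e => query (!a) e
  | controlledQuery a e => controlledQuery (!a) e

variable {Q W : Type} [Fintype Q] [DecidableEq Q] [Fintype W] [DecidableEq W]

lemma eval_adjoint (U : QubitOp Q) (g : Gate Q W) : g.adjoint.eval U = (g.eval U)ᴴ := by
  cases g with
  | primitive k hk e g => simp [adjoint, eval, applyOn_conjTranspose, star_eq_conjTranspose]
  | query a e => cases a <;> simp [adjoint, eval, applyOn_conjTranspose]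
  | controlledQuery a e =>
    cases a <;> simp [adjoint, eval, applyOn_conjTranspose, controlled_conjTranspose]

lemma eval_mem_unitaryGroup {U : QubitOp Q} (hU : U ∈ unitaryGroup (Q → Fin 2) ℂ)
    (g : Gate Q W) : g.eval U ∈ unitaryGroup (W → Fin 2) ℂ := by
  have hU' : Uᴴ ∈ unitaryGroup (Q → Fin 2) ℂ := Unitary.star_mem hU
  cases g with
  | primitive k hk e g => exact applyOn_mem_unitaryGroup e g.2
  | query a e =>
    cases a
    · exact applyOn_mem_unitaryGroup e hU
    · exact applyOn_mem_unitaryGroup e hU'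
  | controlledQuery a e =>
    cases a
    · exact applyOn_mem_unitaryGroup e (controlled_mem_unitaryGroup hU)
    · exact applyOn_mem_unitaryGroup e (controlled_mem_unitaryGroup hU')

end Gate

namespace Circuit

/-- The inverse circuit. -/
def adjoint {Q W : Type} (c : Circuit Q W) : Circuit Q W := (c.map Gate.adjoint).reverse

section counts

variable {Q W : Type}

lemma queryCount_append (c c' : Circuit Q W) :
    queryCount (c ++ c') = queryCount c + queryCount c' := List.countP_append

lemma primitiveCount_append (c c' : Circuit Q W) :
    primitiveCount (c ++ c') = primitiveCount c + primitiveCount c' := List.countP_append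

lemma queryCount_adjoint (c : Circuit Q W) : queryCount c.adjoint = queryCount c := by
  rw [queryCount, queryCount, adjoint, List.countP_reverse, List.countP_map]
  congr 1
  funext g
  cases g <;> rfl

lemma primitiveCount_adjoint (c : Circuit Q W) :
    primitiveCount c.adjoint = primitiveCount c := by
  rw [primitiveCount, primitiveCount, adjoint, List.countP_reverse, List.countP_map]
  congr 1
  funext g
  cases g <;> rfl

end counts

variable {Q W : Type} [Fintype Q] [DecidableEq Q] [Fintype W] [DecidableEq W]

lemma eval_append (U : QubitOp Q) (c c' : Circuit Q W) :
    eval U (c ++ c') = eval U c' * eval U c := by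
  induction c with
  | nil => simp [eval]
  | cons g c ih => rw [List.cons_append, eval, ih, eval, Matrix.mul_assoc]

lemma eval_adjoint (U : QubitOp Q) (c : Circuit Q W) : eval U c.adjoint = (eval U c)ᴴ := by
  induction c with
  | nil => simp [eval, adjoint]
  | cons g c ih =>
    rw [adjoint] at ih
    rw [adjoint, List.map_cons, List.reverse_cons, eval_append, ih, eval, eval, eval,
      Matrix.one_mul, Gate.eval_adjoint, conjTranspose_mul]

lemma eval_mem_unitaryGroup {U : QubitOp Q} (hU : U ∈ unitaryGroup (Q → Fin 2) ℂ)
    (c : Circuit Q W) : eval U c ∈ unitaryGroup (W → Fin 2) ℂ := by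
  induction c with
  | nil => exact one_mem _
  | cons g c ih => exact mul_mem ih (g.eval_mem_unitaryGroup hU)

/-- The action of a circuit on state vectors. -/
def act (U : QubitOp Q) (c : Circuit Q W) (ψ : (W → Fin 2) → ℂ) : (W → Fin 2) → ℂ :=
  eval U c *ᵥ ψ

@[simp] lemma act_nil (U : QubitOp Q) (ψ : (W → Fin 2) → ℂ) :
    act U ([] : Circuit Q W) ψ = ψ := by simp [act, eval]

@[simp] lemma act_append (U : QubitOp Q) (c c' : Circuit Q W) (ψ : (W → Fin 2) → ℂ) :
    act U (c ++ c') ψ = act U c' (act U c ψ) := by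
  simp [act, eval_append]

end Circuit

/-! ### One-qubit gates and controlled one-qubit gates -/

/-- A `2 × 2` matrix as an operator on one qubit. -/
def singleOp (r : Matrix (Fin 2) (Fin 2) ℂ) : QubitOp (Fin 1) :=
  r.submatrix (Equiv.funUnique (Fin 1) (Fin 2)) (Equiv.funUnique (Fin 1) (Fin 2))

/-- The action on state vectors of a one-qubit operator on the wire `t`. -/
def rot {W : Type} [DecidableEq W] (t : W) (r : Matrix (Fin 2) (Fin 2) ℂ)
    (ψ : (W → Fin 2) → ℂ) : (W → Fin 2) → ℂ :=
  fun x => ∑ b, r (x t) b * ψ (Function.update x t b)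

/-- The circuit that consists of a one-qubit gate. -/
def singleGate (Q : Type) {W : Type} (t : W) (r : unitaryGroup (Fin 2) ℂ) : Circuit Q W :=
  [.primitive 1 (Or.inl rfl) ⟨fun _ => t, fun _ _ _ => Subsingleton.elim _ _⟩
    ⟨singleOp r, submatrix_mem_unitaryGroup _ r.2⟩]

open Classical in
/-- The circuit that consists of a controlled one-qubit gate, with control wire `s`; it is empty
if `s = t`. -/
def controlledGate (Q : Type) {W : Type} (s t : W) (r : unitaryGroup (Fin 2) ℂ) :
    Circuit Q W :=
  if h : s ≠ t then
    [.primitive 2 (Or.inr rfl) ⟨![s, t], by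
        intro i j hij
        fin_cases i <;> fin_cases j <;> simp_all⟩
      ⟨(controlled (singleOp r)).submatrix
          ((finSuccEquiv 1).symm.arrowCongr (Equiv.refl (Fin 2))).symm
          ((finSuccEquiv 1).symm.arrowCongr (Equiv.refl (Fin 2))).symm,
        submatrix_mem_unitaryGroup _
          (controlled_mem_unitaryGroup (submatrix_mem_unitaryGroup _ r.2))⟩]
  else []

lemma applyOn_singleOp_mulVec {W : Type} [Fintype W] [DecidableEq W] (e : Fin 1 ↪ W)
    (r : Matrix (Fin 2) (Fin 2) ℂ) (ψ : (W → Fin 2) → ℂ) :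
    applyOn e (singleOp r) *ᵥ ψ = rot (e 0) r ψ := by
  funext x
  rw [applyOn_mulVec, rot, ← (Equiv.funUnique (Fin 1) (Fin 2)).sum_comp]
  refine Finset.sum_congr rfl fun z _ => ?_
  congr 2
  funext w
  by_cases hw : e 0 = w
  · subst hw
    rw [e.injective.extend_apply]; simp
  · rw [extend_of_not_mem, Function.update_of_ne (Ne.symm hw)]
    intro q
    rwa [Subsingleton.elim q 0]

namespace Circuit

variable {Q W : Type} [Fintype Q] [DecidableEq Q] [Fintype W] [DecidableEq W]

@[simp] lemma act_singleGate (U : QubitOp Q) (t : W) (r : unitaryGroup (Fin 2) ℂ)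
    (ψ : (W → Fin 2) → ℂ) : act U (singleGate Q t r) ψ = rot t r ψ := by
  rw [act, singleGate, eval, eval, Matrix.one_mul]
  exact applyOn_singleOp_mulVec _ _ _

lemma act_controlledGate (U : QubitOp Q) {s t : W} (h : s ≠ t) (r : unitaryGroup (Fin 2) ℂ)
    (ψ : (W → Fin 2) → ℂ) :
    act U (controlledGate Q s t r) ψ = fun x => if x s = 1 then rot t r ψ x else ψ x := by
  have e_inj : Function.Injective ![s, t] := by
    intro i j hij
    fin_cases i <;> fin_cases j <;> simp_all
  rw [act, controlledGate, dif_pos h, eval, eval, Matrix.one_mul]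
  let e : Option (Fin 1) ↪ W := (finSuccEquiv 1).symm.toEmbedding.trans ⟨![s, t], e_inj⟩
  have key : Gate.eval U (.primitive 2 (Or.inr rfl) ⟨![s, t], e_inj⟩
      ⟨(controlled (singleOp r)).submatrix
          ((finSuccEquiv 1).symm.arrowCongr (Equiv.refl (Fin 2))).symm
          ((finSuccEquiv 1).symm.arrowCongr (Equiv.refl (Fin 2))).symm,
        submatrix_mem_unitaryGroup _
          (controlled_mem_unitaryGroup (submatrix_mem_unitaryGroup _ r.2))⟩) =
      applyOn e (controlled (singleOp r)) := by
    ext x y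
    simp only [Gate.eval, applyOn]
    have : (∀ w, (∀ q, (⟨![s, t], e_inj⟩ : Fin 2 ↪ W) q ≠ w) → x w = y w) ↔
        (∀ w, (∀ q, e q ≠ w) → x w = y w) := by
      refine forall_congr' fun w => imp_congr_left ?_
      exact ⟨fun h q => h _, fun h q => by simpa [e] using h (finSuccEquiv 1 q)⟩
    simp only [this]
    rfl
  rw [key]
  funext x
  rw [applyOn_controlled_mulVec, applyOn_singleOp_mulVec]
  rfl

end Circuit

end

end Quantum

namespace Quantum

noncomputable section

open Matrix

section counts

variable {Q W : Type}

@[simp] lemma queryCount_singleGate (t : W) (r : unitaryGroup (Fin 2) ℂ) :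
    Circuit.queryCount (singleGate Q t r) = 0 := rfl

@[simp] lemma primitiveCount_singleGate (t : W) (r : unitaryGroup (Fin 2) ℂ) :
    Circuit.primitiveCount (singleGate Q t r) = 1 := rfl

@[simp] lemma queryCount_controlledGate (s t : W) (r : unitaryGroup (Fin 2) ℂ) :
    Circuit.queryCount (controlledGate Q s t r) = 0 := by
  unfold controlledGate; split_ifs <;> rfl

lemma primitiveCount_controlledGate_le (s t : W) (r : unitaryGroup (Fin 2) ℂ) :
    Circuit.primitiveCount (controlledGate Q s t r) ≤ 1 := by
  unfold controlledGate; split_ifs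
  · exact le_rfl
  · exact Nat.zero_le _

end counts

/-! ### Concrete gates and their action on amplitudes -/

section matrices

/-- The Pauli matrix `X`. -/
def pauliX : unitaryGroup (Fin 2) ℂ :=
  ⟨!![0, 1; 1, 0], by
    rw [mem_unitaryGroup_iff]
    ext i j
    fin_cases i <;> fin_cases j <;> simp [Matrix.mul_apply, Matrix.star_apply]⟩

/-- The Pauli matrix `Z`. -/
def pauliZ : unitaryGroup (Fin 2) ℂ :=
  ⟨!![1, 0; 0, -1], by
    rw [mem_unitaryGroup_iff]
    ext i j
    fin_cases i <;> fin_cases j <;> simp [Matrix.mul_apply, Matrix.star_apply]⟩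

/-- A square root of the Pauli matrix `X`. -/
def sqrtX : unitaryGroup (Fin 2) ℂ :=
  ⟨!![(1 + Complex.I) / 2, (1 - Complex.I) / 2; (1 - Complex.I) / 2, (1 + Complex.I) / 2], by
    rw [mem_unitaryGroup_iff]
    ext i j
    fin_cases i <;> fin_cases j <;> simp [Matrix.mul_apply, Matrix.star_apply,
        Complex.conj_ofNat] <;> ring_nf <;> simp [Complex.I_sq] <;> norm_num⟩

lemma ofReal_inv_sqrt_two_mul_self :
    ((Real.sqrt 2)⁻¹ : ℂ) * ((Real.sqrt 2 : ℂ))⁻¹ = 1 / 2 := by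
  rw [← mul_inv, ← Complex.ofReal_mul, Real.mul_self_sqrt (by norm_num)]
  norm_num

/-- The Hadamard matrix. -/
def hadamard : unitaryGroup (Fin 2) ℂ :=
  ⟨((Real.sqrt 2 : ℂ))⁻¹ • !![1, 1; 1, -1], by
    have h := ofReal_inv_sqrt_two_mul_self
    rw [mem_unitaryGroup_iff]
    ext i j
    fin_cases i <;> fin_cases j <;> simp [Matrix.mul_apply, Matrix.star_apply, h] <;> norm_num⟩

lemma sqrtX_mul_sqrtX : (sqrtX : Matrix (Fin 2) (Fin 2) ℂ) * sqrtX = pauliX := by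
  ext i j
  fin_cases i <;> fin_cases j <;> simp [sqrtX, pauliX, Matrix.mul_apply] <;>
      ring_nf <;> simp [Complex.I_sq] <;> norm_num

lemma hadamard_mul_hadamard : (hadamard : Matrix (Fin 2) (Fin 2) ℂ) * hadamard = 1 := by
  have h := ofReal_inv_sqrt_two_mul_self
  ext i j
  fin_cases i <;> fin_cases j <;> simp [hadamard, Matrix.mul_apply, h] <;> norm_num

lemma hadamard_mul_pauliX_mul_hadamard :
    (hadamard : Matrix (Fin 2) (Fin 2) ℂ) * pauliX * hadamard = pauliZ := by
  have h := ofReal_inv_sqrt_two_mul_self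
  ext i j
  fin_cases i <;> fin_cases j <;>
    simp [hadamard, pauliX, pauliZ, Matrix.mul_apply, h, Fin.sum_univ_two] <;> norm_num

end matrices

section rot

variable {W : Type} [DecidableEq W]

lemma rot_rot (t : W) (r s : Matrix (Fin 2) (Fin 2) ℂ) (ψ : (W → Fin 2) → ℂ) :
    rot t r (rot t s ψ) = rot t (r * s) ψ := by
  funext x
  simp only [rot, Function.update_self, Function.update_idem, Matrix.mul_apply, Finset.sum_mul,
    Finset.mul_sum, mul_assoc]
  exact Finset.sum_comm

@[simp] lemma rot_one (t : W) (ψ : (W → Fin 2) → ℂ) : rot t 1 ψ = ψ := by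
  funext x
  rw [rot, Finset.sum_eq_single (x t)]
  · simp
  · intro b _ hb
    rw [Matrix.one_apply_ne hb.symm, zero_mul]
  · simp

lemma fin_two_eq_one_of_ne_zero {b : Fin 2} (h : b ≠ 0) : b = 1 := by omega

lemma fin_two_add_one_add_one (b : Fin 2) : b + 1 + 1 = b := by omega

lemma rot_pauliX (t : W) (ψ : (W → Fin 2) → ℂ) (x : W → Fin 2) :
    rot t pauliX ψ x = ψ (Function.update x t (x t + 1)) := by
  rw [rot, Fin.sum_univ_two]
  by_cases h : x t = 0
  · simp [h, pauliX]
  · simp [fin_two_eq_one_of_ne_zero h, pauliX]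

lemma rot_pauliZ (t : W) (ψ : (W → Fin 2) → ℂ) (x : W → Fin 2) :
    rot t pauliZ ψ x = if x t = 1 then -ψ x else ψ x := by
  rw [rot, Fin.sum_univ_two]
  have hu : Function.update x t (x t) = x := Function.update_eq_self t x
  by_cases h : x t = 0
  · rw [h] at hu; simp [h, pauliZ, hu]
  · have h := fin_two_eq_one_of_ne_zero h
    rw [h] at hu
    simp [h, pauliZ, hu]

open Classical in
/-- A one-qubit operator on the wire `t`, applied if the condition `p` holds. -/
def rotIf (p : (W → Fin 2) → Prop) (t : W) (r : Matrix (Fin 2) (Fin 2) ℂ)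
    (ψ : (W → Fin 2) → ℂ) : (W → Fin 2) → ℂ :=
  fun x => if p x then rot t r ψ x else ψ x

lemma rotIf_pos {p : (W → Fin 2) → Prop} {x : W → Fin 2} (h : p x) (t : W)
    (r : Matrix (Fin 2) (Fin 2) ℂ) (ψ : (W → Fin 2) → ℂ) : rotIf p t r ψ x = rot t r ψ x :=
  if_pos h

lemma rotIf_neg {p : (W → Fin 2) → Prop} {x : W → Fin 2} (h : ¬p x) (t : W)
    (r : Matrix (Fin 2) (Fin 2) ℂ) (ψ : (W → Fin 2) → ℂ) : rotIf p t r ψ x = ψ x :=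
  if_neg h

/-- The condition holds for both values of wire `t`, so both amplitudes entering the outer rotation
have already been rotated. -/
lemma rot_rotIf_pos {p : (W → Fin 2) → Prop} {t : W} {x : W → Fin 2}
    (hp : ∀ b, p (Function.update x t b)) (r s : Matrix (Fin 2) (Fin 2) ℂ)
    (ψ : (W → Fin 2) → ℂ) : rot t r (rotIf p t s ψ) x = rot t (r * s) ψ x := by
  rw [← rot_rot]
  exact Finset.sum_congr rfl fun b _ => by rw [rotIf_pos (hp b)]

lemma rot_rotIf_neg {p : (W → Fin 2) → Prop} {t : W} {x : W → Fin 2}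
    (hp : ∀ b, ¬p (Function.update x t b)) (r s : Matrix (Fin 2) (Fin 2) ℂ)
    (ψ : (W → Fin 2) → ℂ) : rot t r (rotIf p t s ψ) x = rot t r ψ x :=
  Finset.sum_congr rfl fun b _ => by rw [rotIf_neg (hp b)]

end rot

/-! ### Classical reversible maps on basis states -/

section flips

open Classical in
/-- The bit `b`, flipped if `p` holds. -/
def flipBit (p : Prop) (b : Fin 2) : Fin 2 := if p then b + 1 else b

@[simp] lemma flipBit_true (b : Fin 2) : flipBit True b = b + 1 := if_pos trivial

@[simp] lemma flipBit_false (b : Fin 2) : flipBit False b = b := if_neg id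

lemma flipBit_pos {p : Prop} (h : p) (b : Fin 2) : flipBit p b = b + 1 := if_pos h

lemma flipBit_neg {p : Prop} (h : ¬p) (b : Fin 2) : flipBit p b = b := if_neg h

@[simp] lemma flipBit_flipBit (p : Prop) (b : Fin 2) : flipBit p (flipBit p b) = b := by
  by_cases h : p <;> simp [h, fin_two_add_one_add_one]

variable {W : Type} [DecidableEq W]

/-- The map that flips the wire `t` if the condition `p` holds. -/
def flipIf (p : (W → Fin 2) → Prop) (t : W) (s : W → Fin 2) : W → Fin 2 :=
  Function.update s t (flipBit (p s) (s t))

lemma flipIf_pos {p : (W → Fin 2) → Prop} {s : W → Fin 2} (h : p s) (t : W) :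
    flipIf p t s = Function.update s t (s t + 1) := by rw [flipIf, flipBit_pos h]

lemma flipIf_neg {p : (W → Fin 2) → Prop} {s : W → Fin 2} (h : ¬p s) (t : W) :
    flipIf p t s = s := by rw [flipIf, flipBit_neg h, Function.update_eq_self]

/-- Conjugation by NOT turns a control on 1 into a control on 0. -/
lemma flipIf_conj_not {x t : W} (h : x ≠ t) (p q : (W → Fin 2) → Prop)
    (hpq : ∀ s, p (Function.update s x (s x + 1)) ↔ q s) :
    flipIf (fun _ => True) x ∘ flipIf p t ∘ flipIf (fun _ => True) x = flipIf q t := by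
  funext s
  simp only [Function.comp_apply, flipIf, flipBit_true, hpq]
  simp only [Function.update_of_ne h.symm, Function.update_of_ne h, Function.update_self]
  rw [Function.update_comm h.symm, Function.update_idem, fin_two_add_one_add_one,
    Function.update_eq_self]

/-- All wires in the list are `0`. -/
def AllZero {W : Type} (l : List W) (s : W → Fin 2) : Prop := ∀ w ∈ l, s w = 0

instance {W : Type} (l : List W) (s : W → Fin 2) : Decidable (AllZero l s) :=
  inferInstanceAs (Decidable (∀ w ∈ l, s w = 0))

lemma allZero_congr {W : Type} {l : List W} {s s' : W → Fin 2} (h : ∀ w ∈ l, s w = s' w) :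
    AllZero l s ↔ AllZero l s' :=
  forall₂_congr fun w hw => by rw [h w hw]

lemma allZero_update {l : List W} {t : W} (ht : t ∉ l) (s : W → Fin 2) (b : Fin 2) :
    AllZero l (Function.update s t b) ↔ AllZero l s :=
  allZero_congr fun w hw => Function.update_of_ne (by rintro rfl; exact ht hw) _ _

/-- The action of a ladder on basis states: it flips the second wire of each pair if the first
wires of this pair and of all later pairs are `0`. -/
def ladderMap : List (W × W) → (W → Fin 2) → (W → Fin 2)
  | [], s => s
  | p :: l, s => Function.update (ladderMap l s) p.2
      (flipBit (AllZero ((p :: l).map Prod.fst) s) (s p.2))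

lemma ladderMap_of_not_mem {l : List (W × W)} {w : W} (h : w ∉ l.map Prod.snd)
    (s : W → Fin 2) : ladderMap l s w = s w := by
  induction l with
  | nil => rfl
  | cons p l ih =>
    rw [List.map_cons, List.mem_cons, not_or] at h
    rw [ladderMap, Function.update_of_ne h.1, ih h.2]

lemma ladderMap_update {l : List (W × W)} {w : W} (h1 : w ∉ l.map Prod.fst)
    (h2 : w ∉ l.map Prod.snd) (s : W → Fin 2) (b : Fin 2) :
    ladderMap l (Function.update s w b) = Function.update (ladderMap l s) w b := by
  induction l with
  | nil => rfl
  | cons p l ih =>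
    have h1' : w ∉ l.map Prod.fst := fun h => h1 (List.mem_cons_of_mem _ h)
    rw [List.map_cons, List.mem_cons, not_or] at h2
    simp only [ladderMap]
    rw [ih h1' h2.2, Function.update_comm h2.1, Function.update_of_ne (Ne.symm h2.1)]
    simp only [allZero_update h1]

lemma allZero_ladderMap {l : List (W × W)} {k : List W} (h : ∀ w ∈ k, w ∉ l.map Prod.snd)
    (s : W → Fin 2) : AllZero k (ladderMap l s) ↔ AllZero k s :=
  allZero_congr fun w hw => ladderMap_of_not_mem (h w hw) s

/-- The wires of a list of pairs are pairwise distinct. -/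
def DistinctWires {W : Type} (l : List (W × W)) : Prop := (l.map Prod.fst ++ l.map Prod.snd).Nodup

lemma DistinctWires.tail {W : Type} {p : W × W} {l : List (W × W)} (h : DistinctWires (p :: l)) :
    DistinctWires l := by
  refine List.Nodup.sublist ?_ h
  exact List.Sublist.append (List.sublist_cons_self _ _) (List.sublist_cons_self _ _)

lemma DistinctWires.snd_not_mem {W : Type} {p : W × W} {l : List (W × W)} (h : DistinctWires (p :: l)) :
    p.2 ∉ (p :: l).map Prod.fst ∧ p.2 ∉ l.map Prod.snd := by
  rw [DistinctWires, List.nodup_append'] at h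
  refine ⟨fun h' => h.2.2 h' (by simp), ?_⟩
  have := h.2.1
  rw [List.map_cons, List.nodup_cons] at this
  exact this.1

lemma DistinctWires.disjoint {W : Type} {l : List (W × W)} (h : DistinctWires l) {w : W}
    (hw : w ∈ l.map Prod.fst) : w ∉ l.map Prod.snd := by
  rw [DistinctWires, List.nodup_append'] at h
  exact fun h' => h.2.2 hw h'

/-- A ladder writes only to second wires and its conditions read only first wires, so a second run
makes the same flips. -/
lemma ladderMap_ladderMap {l : List (W × W)} (h : DistinctWires l) (s : W → Fin 2) :
    ladderMap l (ladderMap l s) = s := by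
  induction l generalizing s with
  | nil => rfl
  | cons p l ih =>
    have hz : AllZero ((p :: l).map Prod.fst) (ladderMap (p :: l) s) ↔
        AllZero ((p :: l).map Prod.fst) s :=
      allZero_ladderMap (fun w hw => h.disjoint hw) s
    obtain ⟨h1, h2⟩ := h.snd_not_mem
    conv_lhs => rw [ladderMap]
    simp only [hz]
    rw [ladderMap, ladderMap_update (fun h' => h1 (List.mem_cons_of_mem _ h')) h2, ih h.tail,
      Function.update_idem, Function.update_self, flipBit_flipBit, Function.update_eq_self]

lemma distinctWires_zip {W : Type} {l k : List W} (h : l.length ≤ k.length) (hn : (l ++ k).Nodup) :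
    DistinctWires (l.zip k) := by
  rw [DistinctWires, List.map_fst_zip h]
  refine hn.sublist (List.Sublist.append_left ?_ l)
  clear hn h
  induction l generalizing k with
  | nil => simp
  | cons a l ih =>
    cases k with
    | nil => simp
    | cons b k => simpa using ih

end flips

/-! ### Multi-controlled NOT from two-qubit gates -/

section permutations

variable {Q W : Type} [Fintype Q] [DecidableEq Q] [Fintype W] [DecidableEq W]

open Circuit

/-- The circuit acts on state vectors by the substitution `f`. -/
def Permutes (c : Circuit Q W) (f : (W → Fin 2) → (W → Fin 2)) : Prop :=
  ∀ U ψ, act U c ψ = ψ ∘ f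

/-- Amplitudes are pulled back, so the substitution of the earlier circuit stands on the left. -/
lemma Permutes.append {c c' : Circuit Q W} {f f' : (W → Fin 2) → (W → Fin 2)}
    (h : Permutes c f) (h' : Permutes c' f') : Permutes (c ++ c') (f ∘ f') := fun U ψ => by
  rw [act_append, h, h', Function.comp_assoc]

lemma permutes_not (t : W) :
    Permutes (singleGate Q t pauliX) (flipIf (fun _ => True) t) := fun U ψ => by
  funext x
  rw [act_singleGate, rot_pauliX, Function.comp_apply, flipIf_pos trivial]

lemma permutes_cnot {s t : W} (h : s ≠ t) :
    Permutes (controlledGate Q s t pauliX) (flipIf (fun x => x s = 1) t) := fun U ψ => by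
  funext x
  rw [act_controlledGate U h, Function.comp_apply]
  by_cases hx : x s = 1
  · rw [flipIf_pos (p := fun x => x s = 1) hx]; simp only [hx, if_true, rot_pauliX]
  · rw [flipIf_neg (p := fun x => x s = 1) hx]; simp only [hx, if_false]

/-- The gate that flips `t` if `x` is `0`. -/
def zeroControlledNot (Q : Type) {W : Type} (x t : W) : Circuit Q W :=
  singleGate Q x pauliX ++ (controlledGate Q x t pauliX ++ singleGate Q x pauliX)

lemma permutes_zeroControlledNot {x t : W} (h : x ≠ t) :
    Permutes (zeroControlledNot Q x t) (flipIf (fun s => s x = 0) t) := by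
  rw [← flipIf_conj_not h (fun s => s x = 1)]
  · exact (permutes_not x).append ((permutes_cnot h).append (permutes_not x))
  · intro s
    rw [Function.update_self]; omega

/-- The Toffoli gate. -/
def toffoli (Q : Type) {W : Type} (a b t : W) : Circuit Q W :=
  controlledGate Q b t sqrtX ++ (controlledGate Q a b pauliX ++ (controlledGate Q b t (star sqrtX) ++
    (controlledGate Q a b pauliX ++ controlledGate Q a t sqrtX)))

/-- With V² = X, the controlled gates apply V to the power b - (a ⊕ b) + a = 2ab. The CNOTs around
the middle gate turn its control b into a ⊕ b and restore b. -/
lemma permutes_toffoli {a b t : W} (hab : a ≠ b) (hat : a ≠ t) (hbt : b ≠ t) :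
    Permutes (toffoli Q a b t) (flipIf (fun s => s a = 1 ∧ s b = 1) t) := fun U ψ => by
  have hV : (star sqrtX : Matrix (Fin 2) (Fin 2) ℂ) * sqrtX = 1 :=
    mem_unitaryGroup_iff'.mp sqrtX.2
  have hV' : (sqrtX : Matrix (Fin 2) (Fin 2) ℂ) * star (sqrtX : Matrix (Fin 2) (Fin 2) ℂ) = 1 :=
    mem_unitaryGroup_iff.mp sqrtX.2
  have hcond : ∀ {s : W} (hs : s ≠ t) (r : unitaryGroup (Fin 2) ℂ) (φ : (W → Fin 2) → ℂ),
      act U (controlledGate Q s t r) φ = rotIf (fun x => x s = 1) t r φ := by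
    intro s hs r φ
    rw [act_controlledGate U hs]
    funext x
    by_cases h : x s = 1
    · rw [rotIf_pos (p := fun x => x s = 1) h]; simp only [h, if_true]
    · rw [rotIf_neg (p := fun x => x s = 1) h]; simp only [h, if_false]
  have hmid : ∀ φ : (W → Fin 2) → ℂ, act U (controlledGate Q a b pauliX)
      (act U (controlledGate Q b t (star sqrtX)) (act U (controlledGate Q a b pauliX) φ)) =
      rotIf (fun x => (x a = 1 ∧ x b = 0) ∨ (x a = 0 ∧ x b = 1)) t (star sqrtX : Matrix _ _ ℂ) φ := by
    intro φ
    rw [permutes_cnot hab, permutes_cnot hab, hcond hbt]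
    funext x
    rw [Function.comp_apply]
    have hq : ∀ (y : W → Fin 2) (c : Fin 2), flipIf (fun x => x a = 1) b (Function.update y t c) =
        Function.update (flipIf (fun x => x a = 1) b y) t c := by
      intro y c
      simp only [flipIf, Function.update_of_ne hat, Function.update_of_ne hbt,
        Function.update_comm hbt]
    have hqq : flipIf (fun x => x a = 1) b (flipIf (fun x => x a = 1) b x) = x := by
      simp only [flipIf, Function.update_of_ne hab, Function.update_self, Function.update_idem,
        flipBit_flipBit, Function.update_eq_self]
    have ht : flipIf (fun x => x a = 1) b x t = x t := Function.update_of_ne hbt.symm _ _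
    have hb : flipIf (fun x => x a = 1) b x b = flipBit (x a = 1) (x b) :=
      Function.update_self _ _ _
    by_cases hx : flipBit (x a = 1) (x b) = 1
    · rw [rotIf_pos (p := fun x => x b = 1) (hb.trans hx), rotIf_pos]
      · simp only [rot, Function.comp_apply, hq, hqq, ht]
        rfl
      · by_cases ha : x a = 1
        · simp only [ha, flipBit_true] at hx; omega
        · simp only [ha, flipBit_false] at hx; omega
    · rw [rotIf_neg (p := fun x => x b = 1) (fun h => hx (hb.symm.trans h)), rotIf_neg,
        Function.comp_apply, hqq]
      by_cases ha : x a = 1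
      · simp only [ha, flipBit_true] at hx; omega
      · simp only [ha, flipBit_false] at hx; omega
  rw [toffoli]
  simp only [act_append]
  rw [hmid, hcond hbt, hcond hat]
  funext x
  rw [Function.comp_apply]
  have hua : ∀ c, Function.update x t c a = x a := fun c => Function.update_of_ne hat _ _
  have hub : ∀ c, Function.update x t c b = x b := fun c => Function.update_of_ne hbt _ _
  by_cases ha : x a = 1 <;> by_cases hb : x b = 1
  · rw [rotIf_pos (p := fun x => x a = 1) ha, rot_rotIf_neg, rot_rotIf_pos, flipIf_pos ⟨ha, hb⟩,
      sqrtX_mul_sqrtX, rot_pauliX]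
    · exact fun c => (hub c).trans hb
    · intro c; rw [hua, hub]; omega
  · rw [rotIf_pos (p := fun x => x a = 1) ha, rot_rotIf_pos, hV', rot_one, rotIf_neg,
      flipIf_neg (fun h => hb h.2)]
    · exact hb
    · intro c; rw [hua, hub]; omega
  · rw [rotIf_neg (p := fun x => x a = 1) ha, rotIf_pos, rot_rotIf_pos, hV, rot_one,
      flipIf_neg (fun h => ha h.1)]
    · exact fun c => (hub c).trans hb
    · omega
  · rw [rotIf_neg (p := fun x => x a = 1) ha, rotIf_neg, rotIf_neg, flipIf_neg (fun h => ha h.1)]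
    · exact hb
    · omega

/-- The Toffoli gate that flips `t` if `x` is `0` and `b` is `1`. -/
def zeroToffoli (Q : Type) {W : Type} (x b t : W) : Circuit Q W :=
  singleGate Q x pauliX ++ (toffoli Q x b t ++ singleGate Q x pauliX)

lemma permutes_zeroToffoli {x b t : W} (hxb : x ≠ b) (hxt : x ≠ t) (hbt : b ≠ t) :
    Permutes (zeroToffoli Q x b t) (flipIf (fun s => s x = 0 ∧ s b = 1) t) := by
  rw [← flipIf_conj_not hxt (fun s => s x = 1 ∧ s b = 1)]
  · exact (permutes_not x).append ((permutes_toffoli hxb hxt hbt).append (permutes_not x))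
  · intro s
    rw [Function.update_self, Function.update_of_ne hxb.symm]
    refine and_congr_left' ?_
    omega

/-- A ladder of Toffoli gates. It flips the second wire of each pair if the first wires of this
pair and of all later pairs are `0`. -/
def ladder (Q : Type) {W : Type} : List (W × W) → Circuit Q W
  | [] => []
  | [p] => zeroControlledNot Q p.1 p.2
  | p :: q :: l => zeroToffoli Q p.1 q.2 p.2 ++ (ladder Q (q :: l) ++ zeroToffoli Q p.1 q.2 p.2)

/-- The two outer Toffolis add `q.2` to `p.2` when `p.1` is 0, once before and once after the inner
ladder changes `q.2`. The unknown initial value cancels and only the change remains, which is the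
condition that all later first wires are 0. Thus the workspace may be in any state. -/
lemma permutes_ladder {l : List (W × W)} (h : DistinctWires l) :
    Permutes (ladder Q l) (ladderMap l) := by
  induction l with
  | nil => intro U ψ; rw [ladder, act_nil]; rfl
  | cons p l ih =>
    obtain ⟨h1, h2⟩ := h.snd_not_mem
    have hp : p.1 ≠ p.2 := fun h' => h1 (by simp [h'])
    cases l with
    | nil =>
      have : ladderMap [p] = flipIf (fun s => s p.1 = 0) p.2 := by
        funext s
        simp [ladderMap, flipIf, AllZero]
      rw [this]
      exact permutes_zeroControlledNot hp
    | cons q l =>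
      have hpq : p.1 ≠ q.2 := fun h' => h.disjoint (w := p.1) (by simp) (by simp [h'])
      have hqp : q.2 ≠ p.2 := fun h' => h2 (by simp [h'])
      have h1' : p.2 ∉ (q :: l).map Prod.fst := fun h' => h1 (List.mem_cons_of_mem _ h')
      have hp1 : p.1 ∉ (q :: l).map Prod.snd := fun h' =>
        h.disjoint (w := p.1) (by simp) (List.mem_cons_of_mem _ h')
      have key : flipIf (fun s => s p.1 = 0 ∧ s q.2 = 1) p.2 ∘ ladderMap (q :: l) ∘
          flipIf (fun s => s p.1 = 0 ∧ s q.2 = 1) p.2 = ladderMap (p :: q :: l) := by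
        funext s
        have e1 : ladderMap (q :: l) s p.1 = s p.1 := ladderMap_of_not_mem hp1 s
        have e2 : ladderMap (q :: l) s p.2 = s p.2 := ladderMap_of_not_mem h2 s
        have e3 : ∀ b, ladderMap (q :: l) (Function.update s p.2 b) =
          Function.update (ladderMap (q :: l) s) p.2 b := ladderMap_update h1' h2 s
        have e4 : AllZero ((p :: q :: l).map Prod.fst) s ↔
            s p.1 = 0 ∧ AllZero ((q :: l).map Prod.fst) s := by
          simp [AllZero]
        rw [ladderMap]
        simp only [e4]
        have e5 : ladderMap (q :: l) s q.2 =
            flipBit (AllZero ((q :: l).map Prod.fst) s) (s q.2) := by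
          rw [ladderMap, Function.update_self]
        simp only [Function.comp_apply, flipIf, e3, Function.update_of_ne hp,
          Function.update_of_ne hqp, e1, e5, Function.update_self, Function.update_idem]
        congr 1
        generalize AllZero ((q :: l).map Prod.fst) s = z
        by_cases hb : s q.2 = 1
        · by_cases hx : s p.1 = 0 <;> by_cases hz : z <;>
            simp [hx, hz, hb, fin_two_add_one_add_one]
        · replace hb : s q.2 = 0 := by omega
          by_cases hx : s p.1 = 0 <;> by_cases hz : z <;> simp [hx, hz, hb]
      rw [← key]
      have ht := permutes_zeroToffoli (Q := Q) hpq hp hqp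
      exact ht.append ((ih h.tail).append ht)

/-- The gate that flips the second wire of the first pair if all first wires are `0`. The other
second wires serve as workspace. -/
def ladderNot (Q : Type) {W : Type} (l : List (W × W)) : Circuit Q W :=
  ladder Q l ++ ladder Q l.tail

/-- The ladder on the tail undoes every flip except that of the first pair, restoring the borrowed
wires. -/
lemma permutes_ladderNot {p : W × W} {l : List (W × W)} (h : DistinctWires (p :: l)) :
    Permutes (ladderNot Q (p :: l)) (flipIf (AllZero ((p :: l).map Prod.fst)) p.2) := by
  have key : ladderMap (p :: l) ∘ ladderMap l = flipIf (AllZero ((p :: l).map Prod.fst)) p.2 := by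
    funext s
    rw [Function.comp_apply, ladderMap, ladderMap_ladderMap h.tail,
      ladderMap_of_not_mem h.snd_not_mem.2]
    simp only [allZero_ladderMap
      (fun w hw h' => h.disjoint hw (List.mem_cons_of_mem _ h') : ∀ w ∈ (p :: l).map Prod.fst, w ∉ l.map Prod.snd)]
    rw [flipIf]
  rw [← key]
  exact (permutes_ladder h).append (permutes_ladder h.tail)

/-- The circuit that flips `c` if all wires in `A` and in `B` are `0`, with workspace `w`. -/
def multiNot (Q : Type) {W : Type} (A B : List W) (c w : W) : Circuit Q W :=
  (ladderNot Q (A.zip (w :: B)) ++ ladderNot Q ((w :: B).zip (c :: A))) ++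
    (ladderNot Q (A.zip (w :: B)) ++ ladderNot Q ((w :: B).zip (c :: A)))

/-- Each half of the controls borrows wires from the other half. Flipping w on A and then c on (w =
0 and B), both twice, restores w; c is tested once with w flipped by A and once without, so its net
flip is A and B. The length conditions guarantee enough borrowed wires for both halves. -/
lemma permutes_multiNot {A B : List W} {c w : W} (hn : (c :: w :: (A ++ B)).Nodup)
    (hA : A ≠ []) (hAB : A.length ≤ B.length + 1) (hBA : B.length ≤ A.length) :
    Permutes (multiNot Q A B c w) (flipIf (AllZero (A ++ B)) c) := by
  have hc : c ≠ w ∧ c ∉ A ∧ c ∉ B := by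
    simp only [List.nodup_cons, List.mem_cons, List.mem_append, not_or] at hn; tauto
  have hw : w ∉ A ∧ w ∉ B := by
    simp only [List.nodup_cons, List.mem_cons, List.mem_append, not_or] at hn; tauto
  have h1 : Permutes (ladderNot Q (A.zip (w :: B))) (flipIf (AllZero A) w) := by
    have hd : DistinctWires (A.zip (w :: B)) := by
      refine distinctWires_zip (by simpa using hAB) ?_
      exact (List.perm_middle.nodup_iff).mpr (List.nodup_cons.mp hn).2
    have hf : (A.zip (w :: B)).map Prod.fst = A := List.map_fst_zip (by simpa using hAB)
    obtain ⟨a, A', rfl⟩ := List.exists_cons_of_ne_nil hA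
    rw [List.zip_cons_cons] at hd hf ⊢
    have := permutes_ladderNot (Q := Q) hd
    rwa [hf] at this
  have h2 : Permutes (ladderNot Q ((w :: B).zip (c :: A))) (flipIf (AllZero (w :: B)) c) := by
    have hd : DistinctWires ((w :: B).zip (c :: A)) := by
      refine distinctWires_zip (by simpa using hBA) ?_
      refine (List.Perm.nodup_iff ?_).mpr hn
      refine List.perm_middle.trans (List.Perm.cons c ?_)
      exact List.Perm.cons w List.perm_append_comm
    have hf : ((w :: B).zip (c :: A)).map Prod.fst = w :: B := List.map_fst_zip (by simpa using hBA)
    rw [List.zip_cons_cons] at hd hf ⊢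
    have := permutes_ladderNot (Q := Q) hd
    rwa [hf] at this
  have key : (flipIf (AllZero A) w ∘ flipIf (AllZero (w :: B)) c) ∘
      (flipIf (AllZero A) w ∘ flipIf (AllZero (w :: B)) c) = flipIf (AllZero (A ++ B)) c := by
    have hab : ∀ s : W → Fin 2, AllZero (A ++ B) s ↔ AllZero A s ∧ AllZero B s := by
      intro s; simp only [AllZero, List.mem_append, or_imp, forall_and]
    have hwb : ∀ s : W → Fin 2, AllZero (w :: B) s ↔ s w = 0 ∧ AllZero B s := by
      intro s; simp [AllZero]
    funext s
    simp only [Function.comp_apply, flipIf, hwb, hab, allZero_update hc.2.1, allZero_update hc.2.2,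
      allZero_update hw.1, allZero_update hw.2, Function.update_of_ne hc.1,
      Function.update_of_ne hc.1.symm, Function.update_self, Function.update_comm hc.1.symm,
      Function.update_idem, flipBit_flipBit]
    rw [Function.update_comm hc.1, Function.update_eq_self]
    congr 1
    by_cases h0 : s w = 0
    · by_cases ha : AllZero A s <;> by_cases hb : AllZero B s <;>
        simp [ha, hb, h0, fin_two_add_one_add_one]
    · replace h0 := fin_two_eq_one_of_ne_zero h0
      by_cases ha : AllZero A s <;> by_cases hb : AllZero B s <;>
        simp [ha, hb, h0]
  rw [← key]
  exact (h1.append h2).append (h1.append h2)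

/-- The circuit that negates the amplitude if `c` is `1` and all wires in `A` and in `B` are `0`,
with workspace `w`. -/
def multiPhase (Q : Type) {W : Type} (A B : List W) (c w : W) : Circuit Q W :=
  singleGate Q c hadamard ++ (multiNot Q A B c w ++ singleGate Q c hadamard)

/-- The Hadamards turn the flip of c into Z, because HXH = Z where the condition holds and HH = 1
elsewhere; the condition does not read c. -/
lemma act_multiPhase (U : QubitOp Q) {A B : List W} {c w : W} (hn : (c :: w :: (A ++ B)).Nodup)
    (hA : A ≠ []) (hAB : A.length ≤ B.length + 1) (hBA : B.length ≤ A.length)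
    (ψ : (W → Fin 2) → ℂ) (x : W → Fin 2) :
    act U (multiPhase Q A B c w) ψ x = if x c = 1 ∧ AllZero (A ++ B) x then -ψ x else ψ x := by
  have hc : c ∉ A ++ B := by
    have := (List.nodup_cons.mp hn).1
    exact fun h => this (List.mem_cons_of_mem _ h)
  rw [multiPhase, act_append, act_append, act_singleGate, act_singleGate,
    permutes_multiNot hn hA hAB hBA]
  have : rot c hadamard ψ ∘ flipIf (AllZero (A ++ B)) c =
      rotIf (AllZero (A ++ B)) c pauliX (rot c hadamard ψ) := by
    funext y
    rw [Function.comp_apply]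
    by_cases h : AllZero (A ++ B) y
    · rw [flipIf_pos h, rotIf_pos h, rot_pauliX]
    · rw [flipIf_neg h, rotIf_neg h]
  rw [this]
  by_cases h : AllZero (A ++ B) x
  · rw [rot_rotIf_pos (fun b => (allZero_update hc x b).mpr h), rot_rot,
      hadamard_mul_pauliX_mul_hadamard, rot_pauliZ]
    simp [h]
  · rw [rot_rotIf_neg (fun b h' => h ((allZero_update hc x b).mp h')), rot_rot,
      hadamard_mul_hadamard, rot_one]
    simp [h]

end permutations

/-! ### Gate counts for the multi-controlled phase -/

section counts

open Circuit

variable {Q W : Type}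

lemma primitiveCount_toffoli_le (a b t : W) :
    primitiveCount (toffoli Q a b t) ≤ 5 := by
  have := @primitiveCount_controlledGate_le Q W
  simp only [toffoli, primitiveCount_append]
  linarith [this b t sqrtX, this a b pauliX, this b t (star sqrtX), this a t sqrtX]

/-- Each further pair costs two zero-controlled Toffolis, of at most 5 + 2 gates each. -/
lemma primitiveCount_ladder_le (l : List (W × W)) :
    primitiveCount (ladder Q l) ≤ 14 * l.length := by
  induction l with
  | nil => exact le_rfl
  | cons p l ih =>
    cases l with
    | nil =>
      have := primitiveCount_controlledGate_le (Q := Q) p.1 p.2 pauliX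
      simp only [ladder, zeroControlledNot, primitiveCount_append, primitiveCount_singleGate,
        List.length_cons, List.length_nil]
      omega
    | cons q l =>
      have := primitiveCount_toffoli_le (Q := Q) p.1 q.2 p.2
      simp only [ladder, zeroToffoli, primitiveCount_append, primitiveCount_singleGate]
      simp only [List.length_cons] at ih ⊢
      omega

lemma queryCount_ladder (l : List (W × W)) : queryCount (ladder Q l) = 0 := by
  induction l with
  | nil => rfl
  | cons p l ih =>
    cases l with
    | nil => simp [ladder, zeroControlledNot, queryCount_append]
    | cons q l => simp [ladder, zeroToffoli, toffoli, queryCount_append, ih]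

lemma primitiveCount_ladderNot_le (l : List (W × W)) :
    primitiveCount (ladderNot Q l) ≤ 28 * l.length := by
  have h1 := primitiveCount_ladder_le (Q := Q) l
  have h2 := primitiveCount_ladder_le (Q := Q) l.tail
  rw [List.length_tail] at h2
  rw [ladderNot, primitiveCount_append]
  omega

/-- Two rounds of two ladder circuits, with at most |A| and |B| + 1 pairs at 28 gates per pair, plus
two Hadamards. -/
lemma primitiveCount_multiPhase_le (A B : List W) (c w : W) :
    primitiveCount (multiPhase Q A B c w) ≤ 56 * (A.length + B.length + 1) + 2 := by
  have h1 := primitiveCount_ladderNot_le (Q := Q) (A.zip (w :: B))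
  have h2 := primitiveCount_ladderNot_le (Q := Q) ((w :: B).zip (c :: A))
  have h3 : (A.zip (w :: B)).length ≤ A.length := by simp
  have h4 : ((w :: B).zip (c :: A)).length ≤ B.length + 1 := by simp
  simp only [multiPhase, multiNot, primitiveCount_append, primitiveCount_singleGate]
  omega

lemma queryCount_multiPhase (A B : List W) (c w : W) :
    queryCount (multiPhase Q A B c w) = 0 := by
  simp [multiPhase, multiNot, ladderNot, queryCount_append, queryCount_ladder]

end counts

end

end Quantum

namespace Quantum

noncomputable section

open Matrix Polynomial

/-! ### Signal processing with a controlled operator -/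

section subspaces

variable {W : Type} [DecidableEq W]

/-- The state vectors for which the wire `c` is in the state `0`. -/
def zeroSubspace {W : Type} (c : W) : Submodule ℂ ((W → Fin 2) → ℂ) where
  carrier := {ψ | ∀ x, x c ≠ 0 → ψ x = 0}
  add_mem' := fun h h' x hx => by simp [h x hx, h' x hx]
  zero_mem' := fun _ _ => rfl
  smul_mem' := fun a ψ h x hx => by simp [h x hx]

/-- For φ with wire c in state 0, `rot c pauliX φ` is the same state with c in state 1. A rotation
of c thus becomes a 2 × 2 matrix acting on a pair of such φ. -/
lemma rot_of_mem_zeroSubspace {c : W} {φ : (W → Fin 2) → ℂ} (h : φ ∈ zeroSubspace c)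
    (r : Matrix (Fin 2) (Fin 2) ℂ) :
    rot c r φ = r 0 0 • φ + r 1 0 • rot c pauliX φ := by
  funext x
  have h1 : φ (Function.update x c 1) = 0 := h _ (by simp)
  rw [Pi.add_apply, Pi.smul_apply, Pi.smul_apply, rot_pauliX, rot, Fin.sum_univ_two, h1]
  by_cases hx : x c = 0
  · have hu : Function.update x c 0 = x := by rw [← hx, Function.update_eq_self]
    rw [hx, hu, zero_add, h1]
    simp
  · rw [h x hx, fin_two_eq_one_of_ne_zero hx]
    simp

lemma rot_rot_pauliX_of_mem_zeroSubspace {c : W} {φ : (W → Fin 2) → ℂ}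
    (h : φ ∈ zeroSubspace c) (r : Matrix (Fin 2) (Fin 2) ℂ) :
    rot c r (rot c pauliX φ) = r 0 1 • φ + r 1 1 • rot c pauliX φ := by
  rw [rot_rot, rot_of_mem_zeroSubspace h]
  simp [pauliX, Matrix.mul_apply]

lemma rot_add (t : W) (r : Matrix (Fin 2) (Fin 2) ℂ) (φ ψ : (W → Fin 2) → ℂ) :
    rot t r (φ + ψ) = rot t r φ + rot t r ψ := by
  funext x
  simp only [rot, Pi.add_apply, mul_add, Finset.sum_add_distrib]

lemma rot_smul (t : W) (r : Matrix (Fin 2) (Fin 2) ℂ) (a : ℂ) (φ : (W → Fin 2) → ℂ) :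
    rot t r (a • φ) = a • rot t r φ := by
  funext x
  simp only [rot, Pi.smul_apply, smul_eq_mul, Finset.mul_sum]
  exact Finset.sum_congr rfl fun b _ => by ring

lemma rot_pauliX_rot_pauliX (t : W) (φ : (W → Fin 2) → ℂ) :
    rot t pauliX (rot t pauliX φ) = φ := by
  funext x
  rw [rot_pauliX, rot_pauliX, Function.update_self, Function.update_idem,
    fin_two_add_one_add_one, Function.update_eq_self]

end subspaces

section polynomials

lemma aeval_mulVec_mem {ι : Type} [Fintype ι] [DecidableEq ι] {S : Submodule ℂ (ι → ℂ)}
    {M : Matrix ι ι ℂ} (h : ∀ φ ∈ S, M *ᵥ φ ∈ S) (p : ℂ[X]) {φ : ι → ℂ} (hφ : φ ∈ S) :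
    aeval M p *ᵥ φ ∈ S := by
  induction p using Polynomial.induction_on' with
  | add p q hp hq => rw [map_add, add_mulVec]; exact S.add_mem hp hq
  | monomial n a =>
    rw [aeval_monomial, ← Algebra.smul_def, smul_mulVec]
    refine S.smul_mem a ?_
    induction n with
    | zero => simpa using hφ
    | succ n ih => rw [pow_succ', ← mulVec_mulVec]; exact h _ ih

/-- Carries the relation between the walk and 4A² from the operators themselves to all their
polynomials. -/
lemma aeval_mulVec_intertwine {ι κ : Type} [Fintype ι] [DecidableEq ι] [Fintype κ]
    [DecidableEq κ] {M : Matrix ι ι ℂ} {T : Matrix κ κ ℂ} {J : (κ → ℂ) →ₗ[ℂ] (ι → ℂ)}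
    (h : ∀ v, M *ᵥ J v = J (T *ᵥ v)) (p : ℂ[X]) (v : κ → ℂ) :
    aeval M p *ᵥ J v = J (aeval T p *ᵥ v) := by
  induction p using Polynomial.induction_on' with
  | add p q hp hq => rw [map_add, add_mulVec, hp, hq, map_add, add_mulVec, map_add]
  | monomial n a =>
    rw [aeval_monomial, aeval_monomial, ← Algebra.smul_def, ← Algebra.smul_def, smul_mulVec,
      smul_mulVec, map_smul]
    congr 1
    induction n with
    | zero => simp
    | succ n ih => rw [pow_succ', pow_succ', ← mulVec_mulVec, ih, h, mulVec_mulVec]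

end polynomials

section signalProcessing

open Circuit

variable {Q W : Type} [Fintype Q] [DecidableEq Q] [Fintype W] [DecidableEq W]

lemma act_add (U : QubitOp Q) (c : Circuit Q W) (φ ψ : (W → Fin 2) → ℂ) :
    act U c (φ + ψ) = act U c φ + act U c ψ := mulVec_add _ _ _

/-- Rotations of the wire `c` interleaved with the circuit `cw`. The last rotation comes first in
the list. -/
def interleave {Q W : Type} (cw : Circuit Q W) (c : W) :
    List (unitaryGroup (Fin 2) ℂ) → Circuit Q W
  | [] => []
  | r :: l => interleave cw c l ++ (cw ++ singleGate Q c r)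

/-- The power `d` of the inverse of `cw`, with the role of the values of the control wire `c`
exchanged. -/
def undo {Q W : Type} (cw : Circuit Q W) (c : W) : ℕ → Circuit Q W
  | 0 => []
  | d + 1 => undo cw c d ++
      (singleGate Q c pauliX ++ (adjoint cw ++ singleGate Q c pauliX))

/-- The circuit `cw` applies `M` if the wire `c` is `1`. -/
structure ControlsOperator (U : QubitOp Q) (cw : Circuit Q W) (c : W) (M : QubitOp W) : Prop where
  mem : ∀ φ ∈ zeroSubspace c, M *ᵥ φ ∈ zeroSubspace c
  zero : ∀ φ ∈ zeroSubspace c, act U cw φ = φ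
  one : ∀ φ ∈ zeroSubspace c, act U cw (rot c pauliX φ) = rot c pauliX (M *ᵥ φ)

/-- On the two branches of c the controlled circuit is diag(1, M) and a rotation is its scalar
matrix. This is the recursion of `rotationPair` with X replaced by M. -/
lemma ControlsOperator.act_interleave {U : QubitOp Q} {cw : Circuit Q W} {c : W} {M : QubitOp W}
    (h : ControlsOperator U cw c M) (l : List (unitaryGroup (Fin 2) ℂ))
    {φ : (W → Fin 2) → ℂ} (hφ : φ ∈ zeroSubspace c) :
    act U (interleave cw c l) φ = aeval M (rotationPair l).1 *ᵥ φ +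
      rot c pauliX (aeval M (rotationPair l).2 *ᵥ φ) := by
  induction l with
  | nil =>
    funext x
    simp [interleave, rotationPair, rot]
  | cons r l ih =>
    have h1 : aeval M (rotationPair l).1 *ᵥ φ ∈ zeroSubspace c := aeval_mulVec_mem h.mem _ hφ
    have h2 : aeval M (rotationPair l).2 *ᵥ φ ∈ zeroSubspace c := aeval_mulVec_mem h.mem _ hφ
    rw [interleave, act_append, act_append, ih, act_add, h.zero _ h1, h.one _ h2,
      act_singleGate, rot_add, rot_of_mem_zeroSubspace h1,
      rot_rot_pauliX_of_mem_zeroSubspace (h.mem _ h2)]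
    simp only [rotationPair, map_add, map_mul, aeval_C, aeval_X, add_mulVec,
      ← Algebra.smul_def, smul_mulVec, rot_add, rot_smul, ← mulVec_mulVec]
    abel

/-- The NOTs around each controlled step exchange the branches, so M acts where c is 0 and the other
branch is untouched. In the application M is the inverse of the walk. -/
lemma ControlsOperator.act_undo {U : QubitOp Q} {cw : Circuit Q W} {c : W} {M : QubitOp W}
    (h : ControlsOperator U (adjoint cw) c M) (d : ℕ)
    {φ φ' : (W → Fin 2) → ℂ} (hφ : φ ∈ zeroSubspace c) (hφ' : φ' ∈ zeroSubspace c) :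
    act U (undo cw c d) (φ + rot c pauliX φ') = M ^ d *ᵥ φ + rot c pauliX φ' := by
  induction d with
  | zero => simp [undo]
  | succ d ih =>
    have h1 : M ^ d *ᵥ φ ∈ zeroSubspace c := by
      have := aeval_mulVec_mem h.mem (X ^ d) hφ
      simpa using this
    rw [undo, act_append, act_append, act_append, ih, act_singleGate, act_singleGate, rot_add,
      rot_pauliX_rot_pauliX, act_add, h.zero _ hφ', h.one _ h1, rot_add, rot_pauliX_rot_pauliX,
      pow_succ', ← mulVec_mulVec]

lemma ControlsOperator.adjoint {U : QubitOp Q} (hU : U ∈ unitaryGroup (Q → Fin 2) ℂ)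
    {cw : Circuit Q W} {c : W} {M : QubitOp W} (h : ControlsOperator U cw c M)
    (hM : M * Mᴴ = 1) (hmem : ∀ φ ∈ zeroSubspace c, Mᴴ *ᵥ φ ∈ zeroSubspace c) :
    ControlsOperator U (Circuit.adjoint cw) c Mᴴ := by
  have hinv : ∀ φ ψ, act U cw φ = ψ → act U (Circuit.adjoint cw) ψ = φ := by
    rintro φ ψ rfl
    rw [act, act, Circuit.eval_adjoint, mulVec_mulVec, ← star_eq_conjTranspose,
      mem_unitaryGroup_iff'.mp (Circuit.eval_mem_unitaryGroup hU cw), one_mulVec]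
  refine ⟨hmem, fun φ hφ => hinv _ _ (h.zero φ hφ), fun φ hφ => hinv _ _ ?_⟩
  rw [h.one _ (hmem φ hφ), mulVec_mulVec, hM, one_mulVec]

end signalProcessing

/-! ### Circuits that leave a wire untouched -/

section avoiding

variable {Q W : Type} [Fintype Q] [DecidableEq Q] [Fintype W] [DecidableEq W]

lemma applyOn_mulVec_mem_zeroSubspace {e : Q ↪ W} {c : W} (h : ∀ q, e q ≠ c) (M : QubitOp Q)
    {φ : (W → Fin 2) → ℂ} (hφ : φ ∈ zeroSubspace c) : applyOn e M *ᵥ φ ∈ zeroSubspace c := by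
  intro x hx
  rw [applyOn_mulVec]
  refine Finset.sum_eq_zero fun z _ => ?_
  rw [hφ _ (by rwa [extend_of_not_mem e z x h]), mul_zero]

lemma applyOn_mulVec_rot_pauliX {e : Q ↪ W} {c : W} (h : ∀ q, e q ≠ c) (M : QubitOp Q)
    (φ : (W → Fin 2) → ℂ) :
    applyOn e M *ᵥ rot c pauliX φ = rot c pauliX (applyOn e M *ᵥ φ) := by
  funext x
  rw [rot_pauliX, applyOn_mulVec, applyOn_mulVec]
  refine Finset.sum_congr rfl fun z _ => ?_
  have h1 : Function.update x c (x c + 1) ∘ e = x ∘ e :=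
    funext fun q => Function.update_of_ne (h q) _ _
  rw [rot_pauliX, h1, extend_of_not_mem e z x h]
  congr 2
  funext w
  by_cases hw : ∃ q, e q = w
  · obtain ⟨q, rfl⟩ := hw
    rw [Function.update_of_ne (h q), e.injective.extend_apply, e.injective.extend_apply]
  · push Not at hw
    rw [extend_of_not_mem e _ _ hw]
    by_cases hc : w = c
    · subst hc; simp
    · rw [Function.update_of_ne hc, Function.update_of_ne hc, extend_of_not_mem e _ _ hw]

/-- The gate does not touch the wire `c`. -/
def Gate.Avoids {Q W : Type} (c : W) : Gate Q W → Prop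
  | primitive _ _ e _ => ∀ q, e q ≠ c
  | query _ e => ∀ q, e q ≠ c
  | controlledQuery _ e => ∀ q, e q ≠ c

lemma Gate.Avoids.adjoint {Q W : Type} {c : W} {g : Gate Q W} (h : g.Avoids c) :
    g.adjoint.Avoids c := by
  cases g <;> exact h

/-- The circuit does not touch the wire `c`. -/
def Circuit.Avoids {Q W : Type} (c : W) (C : Circuit Q W) : Prop := ∀ g ∈ C, g.Avoids c

lemma Circuit.Avoids.adjoint {Q W : Type} {c : W} {C : Circuit Q W} (h : C.Avoids c) :
    Circuit.Avoids c (Circuit.adjoint C) := by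
  intro g hg
  rw [Circuit.adjoint, List.mem_reverse, List.mem_map] at hg
  obtain ⟨g', hg', rfl⟩ := hg
  exact (h g' hg').adjoint

lemma Gate.Avoids.eval {c : W} {g : Gate Q W} (h : g.Avoids c) (U : QubitOp Q) :
    (∀ φ ∈ zeroSubspace c, g.eval U *ᵥ φ ∈ zeroSubspace c) ∧
      ∀ φ, g.eval U *ᵥ rot c pauliX φ = rot c pauliX (g.eval U *ᵥ φ) := by
  cases g with
  | primitive k hk e g =>
    exact ⟨fun φ hφ => applyOn_mulVec_mem_zeroSubspace h _ hφ, applyOn_mulVec_rot_pauliX h _⟩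
  | query a e =>
    exact ⟨fun φ hφ => applyOn_mulVec_mem_zeroSubspace h _ hφ, applyOn_mulVec_rot_pauliX h _⟩
  | controlledQuery a e =>
    exact ⟨fun φ hφ => applyOn_mulVec_mem_zeroSubspace h _ hφ, applyOn_mulVec_rot_pauliX h _⟩

lemma Circuit.Avoids.eval {c : W} {C : Circuit Q W} (h : C.Avoids c) (U : QubitOp Q) :
    (∀ φ ∈ zeroSubspace c, C.eval U *ᵥ φ ∈ zeroSubspace c) ∧
      ∀ φ, C.eval U *ᵥ rot c pauliX φ = rot c pauliX (C.eval U *ᵥ φ) := by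
  induction C with
  | nil => simp [Circuit.eval]
  | cons g C ih =>
    have hg := (h g List.mem_cons_self).eval U
    have ih := ih fun g' hg' => h g' (List.mem_cons_of_mem _ hg')
    rw [Circuit.eval]
    refine ⟨fun φ hφ => ?_, fun φ => ?_⟩
    · rw [← mulVec_mulVec]
      exact ih.1 _ (hg.1 φ hφ)
    · rw [← mulVec_mulVec, hg.2, ih.2, mulVec_mulVec]

end avoiding

/-! ### The walk operator and its controlled circuit -/

section walk

open Circuit

variable {Q W : Type} [Fintype Q] [DecidableEq Q] [Fintype W] [DecidableEq W]

/-- The reflection about the complement of the space in which all wires of `L` are `0`. -/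
def zeroReflection (L : List W) : QubitOp W := diagonal fun x => if AllZero L x then -1 else 1

/-- The walk operator, with respect to the operator `V` and the reflection on the wires `L`. -/
def walkOp (L : List W) (V : QubitOp W) : QubitOp W :=
  -(Vᴴ * zeroReflection L * V * zeroReflection L)

lemma zeroReflection_mul_self (L : List W) : zeroReflection L * zeroReflection L = 1 := by
  rw [zeroReflection, diagonal_mul_diagonal, ← diagonal_one]
  congr 1
  funext x
  split_ifs <;> norm_num

lemma zeroReflection_conjTranspose {W : Type} [Fintype W] [DecidableEq W] (L : List W) : (zeroReflection L)ᴴ = zeroReflection L := by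
  rw [zeroReflection, diagonal_conjTranspose]
  congr 1
  funext x
  rw [Pi.star_apply]
  split_ifs <;> simp

lemma walkOp_conjTranspose (L : List W) (V : QubitOp W) :
    (walkOp L V)ᴴ = -(zeroReflection L * Vᴴ * zeroReflection L * V) := by
  simp [walkOp, zeroReflection_conjTranspose, Matrix.mul_assoc]

lemma walkOp_mem_unitaryGroup (L : List W) {V : QubitOp W}
    (hV : V ∈ unitaryGroup (W → Fin 2) ℂ) : walkOp L V ∈ unitaryGroup (W → Fin 2) ℂ := by
  have hN : zeroReflection L ∈ unitaryGroup (W → Fin 2) ℂ := by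
    rw [mem_unitaryGroup_iff, star_eq_conjTranspose, zeroReflection_conjTranspose,
      zeroReflection_mul_self]
  have h : Vᴴ * zeroReflection L * V * zeroReflection L ∈ unitaryGroup (W → Fin 2) ℂ :=
    mul_mem (mul_mem (mul_mem (Unitary.star_mem hV) hN) hV) hN
  rw [walkOp, mem_unitaryGroup_iff, star_neg, neg_mul_neg]
  exact mem_unitaryGroup_iff.mp h

lemma zeroReflection_mulVec_mem (L : List W) {c : W} {φ : (W → Fin 2) → ℂ}
    (h : φ ∈ zeroSubspace c) : zeroReflection L *ᵥ φ ∈ zeroSubspace c := by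
  intro x hx
  rw [zeroReflection, mulVec_diagonal, h x hx, mul_zero]

/-- The circuit that applies the walk operator of `V` if the wire `c` is `1`, with workspace
`w`. -/
def walkCircuit (V : Circuit Q W) (A B : List W) (c w : W) : Circuit Q W :=
  multiPhase Q A B c w ++ (V ++ (multiPhase Q A B c w ++ (adjoint V ++ singleGate Q c pauliZ)))

/-- V itself is not controlled: if c is 0, the phases do nothing and V†V cancels. If c is 1, the
phases act as the two reflections and the Z gate on c supplies the minus sign. -/
lemma controlsOperator_walkCircuit {U : QubitOp Q} (hU : U ∈ unitaryGroup (Q → Fin 2) ℂ)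
    {V : Circuit Q W} {A B : List W} {c w : W} (hV : V.Avoids c)
    (hn : (c :: w :: (A ++ B)).Nodup) (hA : A ≠ []) (hAB : A.length ≤ B.length + 1)
    (hBA : B.length ≤ A.length) :
    ControlsOperator U (walkCircuit V A B c w) c (walkOp (A ++ B) (eval U V)) := by
  have hc : c ∉ A ++ B := fun h => (List.nodup_cons.mp hn).1 (List.mem_cons_of_mem _ h)
  have hphase0 : ∀ φ ∈ zeroSubspace c, act U (multiPhase Q A B c w) φ = φ := by
    intro φ hφ
    funext x
    rw [act_multiPhase U hn hA hAB hBA]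
    split_ifs with h
    · rw [hφ x (by rw [h.1]; decide), neg_zero]
    · rfl
  have hphase1 : ∀ φ ∈ zeroSubspace c, act U (multiPhase Q A B c w) (rot c pauliX φ) =
      rot c pauliX (zeroReflection (A ++ B) *ᵥ φ) := by
    intro φ hφ
    funext x
    rw [act_multiPhase U hn hA hAB hBA, rot_pauliX, rot_pauliX, zeroReflection, mulVec_diagonal]
    by_cases hx : x c = 1
    · by_cases hz : AllZero (A ++ B) x
      · rw [if_pos ⟨hx, hz⟩, if_pos ((allZero_update hc _ _).mpr hz), neg_one_mul]
      · rw [if_neg (fun h => hz h.2), if_neg (fun h => hz ((allZero_update hc _ _).mp h)), one_mul]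
    · have h0 : φ (Function.update x c (x c + 1)) = 0 := hφ _ (by
        rw [Function.update_self]; omega)
      rw [if_neg (fun h => hx h.1), h0, mul_zero]
  have hZ0 : ∀ φ ∈ zeroSubspace c, rot c pauliZ φ = φ := by
    intro φ hφ
    rw [rot_of_mem_zeroSubspace hφ]; simp [pauliZ]
  have hZ1 : ∀ φ ∈ zeroSubspace c, rot c pauliZ (rot c pauliX φ) = rot c pauliX (-φ) := by
    intro φ hφ
    rw [rot_rot_pauliX_of_mem_zeroSubspace hφ, ← neg_one_smul ℂ φ, rot_smul]; simp [pauliZ]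
  have hV1 := hV.eval U
  have hV2 := hV.adjoint.eval U
  rw [Circuit.eval_adjoint] at hV2
  have hN := fun φ => zeroReflection_mulVec_mem (A ++ B) (c := c) (φ := φ)
  have hunit : (eval U V)ᴴ * eval U V = 1 :=
    mem_unitaryGroup_iff'.mp (Circuit.eval_mem_unitaryGroup hU V)
  refine ⟨fun φ hφ => ?_, fun φ hφ => ?_, fun φ hφ => ?_⟩
  · rw [walkOp, neg_mulVec, ← mulVec_mulVec, ← mulVec_mulVec, ← mulVec_mulVec]
    exact Submodule.neg_mem _ (hV2.1 _ (hN _ (hV1.1 _ (hN _ hφ))))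
  · simp only [walkCircuit, act_append, act_singleGate]
    rw [hphase0 φ hφ, act.eq_1 U V, hphase0 _ (hV1.1 φ hφ), act, Circuit.eval_adjoint,
      mulVec_mulVec, hunit, one_mulVec, hZ0 φ hφ]
  · simp only [walkCircuit, act_append, act_singleGate]
    have h1 := hN _ hφ
    have h2 := hV1.1 _ h1
    have h3 := hN _ h2
    rw [hphase1 φ hφ, act.eq_1 U V, hV1.2, hphase1 _ h2, act, Circuit.eval_adjoint, hV2.2,
      hZ1 _ (hV2.1 _ h3), walkOp, neg_mulVec]
    simp only [mulVec_mulVec, Matrix.mul_assoc]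

end walk

end

end Quantum

namespace Quantum

noncomputable section

open Matrix Polynomial Circuit

/-! ### Ancilla blocks and the algebra of the walk -/

/-- The state vector `|0^a⟩ ⊗ v`. -/
def embedZero (a n : ℕ) : ((Fin n → Fin 2) → ℂ) →ₗ[ℂ] ((Fin a ⊕ Fin n → Fin 2) → ℂ) where
  toFun v x := if ∀ i, x (Sum.inl i) = 0 then v (x ∘ Sum.inr) else 0
  map_add' v v' := by
    funext x
    by_cases h : ∀ i, x (Sum.inl i) = 0 <;> simp [h]
  map_smul' b v := by
    funext x
    by_cases h : ∀ i, x (Sum.inl i) = 0 <;> simp [h]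

lemma embedZero_of_zero {a n : ℕ} (v : (Fin n → Fin 2) → ℂ) {x : Fin a ⊕ Fin n → Fin 2}
    (h : ∀ i, x (Sum.inl i) = 0) : embedZero a n v x = v (x ∘ Sum.inr) := if_pos h

lemma embedZero_of_not_zero {a n : ℕ} (v : (Fin n → Fin 2) → ℂ) {x : Fin a ⊕ Fin n → Fin 2}
    (h : ¬∀ i, x (Sum.inl i) = 0) : embedZero a n v x = 0 := if_neg h

lemma embedZero_elim {a n : ℕ} (v : (Fin n → Fin 2) → ℂ) (y : Fin n → Fin 2) :
    embedZero a n v (Sum.elim (fun _ => 0) y) = v y :=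
  embedZero_of_zero v fun _ => rfl

lemma eq_elim_of_zero {a n : ℕ} {x : Fin a ⊕ Fin n → Fin 2} (h : ∀ i, x (Sum.inl i) = 0) :
    x = Sum.elim (fun _ => 0) (x ∘ Sum.inr) := by
  funext w
  cases w with
  | inl i => exact h i
  | inr j => rfl

lemma sum_mul_embedZero {a n : ℕ} (f : (Fin a ⊕ Fin n → Fin 2) → ℂ) (v : (Fin n → Fin 2) → ℂ) :
    ∑ x, f x * embedZero a n v x = ∑ y, f (Sum.elim (fun _ => 0) y) * v y := by
  symm
  refine Fintype.sum_of_injective (fun y => Sum.elim (fun _ => 0) y) ?_ _ _ ?_ ?_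
  · intro y y' h
    have := congrArg (· ∘ Sum.inr) h
    simpa using this
  · intro x hx
    rw [embedZero_of_not_zero, mul_zero]
    exact fun h => hx ⟨x ∘ Sum.inr, (eq_elim_of_zero h).symm⟩
  · intro y
    rw [embedZero_elim]

lemma ancillaBlock_mulVec {a n : ℕ} (E : QubitOp (Fin a ⊕ Fin n)) (v : (Fin n → Fin 2) → ℂ)
    (y : Fin n → Fin 2) :
    (ancillaBlock E *ᵥ v) y = (E *ᵥ embedZero a n v) (Sum.elim (fun _ => 0) y) :=
  (sum_mul_embedZero (E (Sum.elim (fun _ => 0) y)) v).symm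

lemma ancillaBlock_conjTranspose {a n : ℕ} (E : QubitOp (Fin a ⊕ Fin n)) :
    ancillaBlock Eᴴ = (ancillaBlock E)ᴴ := rfl

/-- The squared distance of the walk operator from the identity acts on the main register. -/
lemma walkOp_mulVec_embedZero {a n : ℕ} {L : List (Fin a ⊕ Fin n)} {V : QubitOp (Fin a ⊕ Fin n)}
    {A : QubitOp (Fin n)} (hV : Vᴴ * V = 1)
    (h0 : ∀ v, zeroReflection L *ᵥ embedZero a n v = -embedZero a n v)
    (h1 : ∀ v, zeroReflection L *ᵥ (V *ᵥ embedZero a n v) =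
      V *ᵥ embedZero a n v - (2 : ℂ) • embedZero a n (A *ᵥ v))
    (h2 : ∀ v, zeroReflection L *ᵥ (Vᴴ *ᵥ embedZero a n v) =
      Vᴴ *ᵥ embedZero a n v - (2 : ℂ) • embedZero a n (A *ᵥ v)) (v : (Fin n → Fin 2) → ℂ) :
    (2 - walkOp L V - (walkOp L V)ᴴ) *ᵥ embedZero a n v =
      embedZero a n (((4 : ℂ) • (A * A)) *ᵥ v) := by
  have hVV : ∀ φ, Vᴴ *ᵥ (V *ᵥ φ) = φ := fun φ => by rw [mulVec_mulVec, hV, one_mulVec]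
  have hw : walkOp L V *ᵥ embedZero a n v =
      embedZero a n v - (2 : ℂ) • Vᴴ *ᵥ embedZero a n (A *ᵥ v) := by
    rw [walkOp, neg_mulVec, ← mulVec_mulVec, ← mulVec_mulVec, ← mulVec_mulVec, h0, mulVec_neg,
      mulVec_neg, mulVec_neg, neg_neg, h1, mulVec_sub, hVV, mulVec_smul]
  -- V†(|0⟩ ⊗ Av), which leaves the embedded space in general, occurs with opposite signs in W and
  -- W†. Only the sum W + W† = 2 - 4A² preserves that space.
  have hw' : (walkOp L V)ᴴ *ᵥ embedZero a n v = embedZero a n v +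
      (2 : ℂ) • (Vᴴ *ᵥ embedZero a n (A *ᵥ v) - (2 : ℂ) • embedZero a n (A *ᵥ (A *ᵥ v))) := by
    rw [walkOp_conjTranspose, neg_mulVec, ← mulVec_mulVec, ← mulVec_mulVec, ← mulVec_mulVec, h1,
      mulVec_sub, hVV, mulVec_smul, mulVec_sub, h0, mulVec_smul, h2]
    abel
  have htwo : (2 : QubitOp (Fin a ⊕ Fin n)) *ᵥ embedZero a n v = (2 : ℂ) • embedZero a n v := by
    have : (2 : QubitOp (Fin a ⊕ Fin n)) = 1 + 1 := one_add_one_eq_two.symm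
    rw [this, add_mulVec, one_mulVec, two_smul]
  rw [sub_mulVec, sub_mulVec, hw, hw', htwo, smul_mulVec, map_smul, ← mulVec_mulVec]
  module

/-! ### Wire layout and the circuit for a polynomial of 4A² -/

/-- The wires of the black box. -/
def blackBoxWires (m n : ℕ) : Fin m ⊕ Fin n ↪ Fin (m + 3) ⊕ Fin n :=
  ⟨Sum.map (Fin.castAdd 3) id,
    Function.Injective.sumMap (Fin.castAdd_injective m 3) Function.injective_id⟩

/-- The three additional wires. -/
def extraWire (m n : ℕ) (i : Fin 3) : Fin (m + 3) ⊕ Fin n := Sum.inl (Fin.natAdd m i)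

lemma extraWire_injective (m n : ℕ) : Function.Injective (extraWire m n) := fun _ _ h =>
  Fin.natAdd_injective 3 m (Sum.inl_injective h)

lemma blackBoxWires_ne_extraWire {m n : ℕ} (q : Fin m ⊕ Fin n) (i : Fin 3) :
    blackBoxWires m n q ≠ extraWire m n i := by
  cases q with
  | inl q =>
    intro h
    have := congrArg Fin.val (Sum.inl_injective h)
    simp at this
    omega
  | inr q => exact fun h => Sum.inr_ne_inl h

/-- The black box with its control wire. -/
def controlledBlackBoxWires (m n : ℕ) : Option (Fin m ⊕ Fin n) ↪ Fin (m + 3) ⊕ Fin n :=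
  (blackBoxWires m n).optionElim (extraWire m n 1)
    (fun ⟨q, hq⟩ => blackBoxWires_ne_extraWire q 1 hq)

/-- The circuit that encodes a linear combination of the identity and the black box. -/
def shiftCircuit (m n : ℕ) (R R' : unitaryGroup (Fin 2) ℂ) :
    Circuit (Fin m ⊕ Fin n) (Fin (m + 3) ⊕ Fin n) :=
  singleGate _ (extraWire m n 1) R ++
    ([.controlledQuery false (controlledBlackBoxWires m n)] ++ singleGate _ (extraWire m n 1) R')

lemma shiftCircuit_avoids (m n : ℕ) (R R' : unitaryGroup (Fin 2) ℂ) {i : Fin 3} (hi : 1 ≠ i) :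
    (shiftCircuit m n R R').Avoids (extraWire m n i) := by
  have h1 : extraWire m n 1 ≠ extraWire m n i := fun h => hi (extraWire_injective m n h)
  intro g hg
  simp only [shiftCircuit, singleGate, List.mem_append, List.mem_singleton] at hg
  rcases hg with rfl | rfl | rfl
  · exact fun _ => h1
  · intro q
    cases q with
    | none => exact h1
    | some q => exact blackBoxWires_ne_extraWire q i
  · exact fun _ => h1

lemma extend_blackBoxWires_extraWire {m n : ℕ} (z : Fin m ⊕ Fin n → Fin 2)
    (x : Fin (m + 3) ⊕ Fin n → Fin 2) (i : Fin 3) :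
    Function.extend (blackBoxWires m n) z x (extraWire m n i) = x (extraWire m n i) :=
  extend_of_not_mem _ _ _ fun q => blackBoxWires_ne_extraWire q i

lemma forall_inl_iff {m n : ℕ} (x : Fin (m + 3) ⊕ Fin n → Fin 2) :
    (∀ i, x (Sum.inl i) = 0) ↔
      (∀ i, x (blackBoxWires m n (Sum.inl i)) = 0) ∧ ∀ i, x (extraWire m n i) = 0 :=
  Fin.forall_fin_add _

/-- Linear combination of unitaries: starting and ending in 0 on the control wire, one sums over its
intermediate values, where 0 contributes the identity and 1 the black box. -/
lemma ancillaBlock_shiftCircuit (m n : ℕ) (R R' : unitaryGroup (Fin 2) ℂ)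
    (U : QubitOp (Fin m ⊕ Fin n)) :
    ancillaBlock (eval U (shiftCircuit m n R R')) =
      (R'.1 0 0 * R.1 0 0) • (1 : QubitOp (Fin n)) + (R'.1 0 1 * R.1 1 0) • ancillaBlock U := by
  refine eq_of_forall_mulVec fun v => funext fun y => ?_
  have hne : ∀ q, blackBoxWires m n q ≠ extraWire m n 1 := fun q => blackBoxWires_ne_extraWire q 1
  rw [ancillaBlock_mulVec]
  change act U (shiftCircuit m n R R') (embedZero (m + 3) n v) _ = _
  set x : Fin (m + 3) ⊕ Fin n → Fin 2 := Sum.elim (fun _ => 0) y with hx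
  have hx0 : x (extraWire m n 1) = 0 := rfl
  have hmem : embedZero (m + 3) n v ∈ zeroSubspace (extraWire m n 1) := fun x' h' =>
    embedZero_of_not_zero v fun h => h' (h _)
  have hR0 : rot (extraWire m n 1) R.1 (embedZero (m + 3) n v) x = R.1 0 0 * v y := by
    rw [rot, Fin.sum_univ_two, hx0, hmem (Function.update x _ 1) (by simp), mul_zero, add_zero,
      ← hx0, Function.update_eq_self, hx, embedZero_elim]
  have hR1 : ∀ z : Fin m ⊕ Fin n → Fin 2, rot (extraWire m n 1) R.1 (embedZero (m + 3) n v)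
      (Function.extend (blackBoxWires m n) z (Function.update x (extraWire m n 1) 1)) =
      R.1 1 0 * embedZero m n v z := by
    intro z
    rw [rot, Fin.sum_univ_two, extend_blackBoxWires_extraWire, Function.update_self,
      hmem (Function.update _ _ 1) (by simp), mul_zero, add_zero]
    congr 1
    have hw : ∀ q, Function.update (Function.extend (blackBoxWires m n) z
        (Function.update x (extraWire m n 1) 1)) (extraWire m n 1) 0 (blackBoxWires m n q) = z q :=
      fun q => by rw [Function.update_of_ne (hne q), (blackBoxWires m n).injective.extend_apply]
    have he : ∀ i, Function.update (Function.extend (blackBoxWires m n) z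
        (Function.update x (extraWire m n 1) 1)) (extraWire m n 1) 0 (extraWire m n i) = 0 := by
      intro i
      by_cases hi : i = 1
      · rw [hi, Function.update_self]
      · have hi' : extraWire m n i ≠ extraWire m n 1 := fun h => hi (extraWire_injective m n h)
        rw [Function.update_of_ne hi', extend_blackBoxWires_extraWire, Function.update_of_ne hi']
        rfl
    by_cases hz : ∀ i, z (Sum.inl i) = 0
    · rw [embedZero_of_zero v hz, embedZero_of_zero]
      · congr 1
        exact funext fun j => hw (Sum.inr j)
      · exact (forall_inl_iff _).mpr ⟨fun i => (hw _).trans (hz i), he⟩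
    · rw [embedZero_of_not_zero v hz, embedZero_of_not_zero]
      exact fun h => hz fun i => (hw _).symm.trans (((forall_inl_iff _).mp h).1 i)
  have hq : ∀ ψ x', act U [.controlledQuery false (controlledBlackBoxWires m n)] ψ x' =
      if x' (extraWire m n 1) = 1 then (applyOn (blackBoxWires m n) U *ᵥ ψ) x' else ψ x' := by
    intro ψ x'
    rw [act, Circuit.eval, Circuit.eval, Matrix.one_mul]
    exact applyOn_controlled_mulVec _ _ _ _
  simp only [shiftCircuit, act_append, act_singleGate]
  rw [rot, Fin.sum_univ_two, hx0, hq, hq, Function.update_self, Function.update_self,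
    if_neg (by decide), if_pos rfl, applyOn_mulVec]
  simp only [hR1]
  have hu : Function.update x (extraWire m n 1) 0 = x := by
    rw [← hx0, Function.update_eq_self]
  have hcomp : Function.update x (extraWire m n 1) 1 ∘ blackBoxWires m n =
      Sum.elim (fun _ => 0) y := by
    funext q
    rw [Function.comp_apply, Function.update_of_ne (hne q)]
    cases q <;> rfl
  rw [hu, hR0, hcomp, add_mulVec, smul_mulVec, smul_mulVec, one_mulVec, Pi.add_apply,
    Pi.smul_apply, Pi.smul_apply, mulVec, dotProduct, smul_eq_mul, smul_eq_mul]
  have := sum_mul_embedZero (fun z => U (Sum.elim (fun _ => 0) y) z) v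
  simp only [ancillaBlock]
  rw [← this, mul_assoc, Finset.mul_sum, Finset.mul_sum]
  congr 1
  exact Finset.sum_congr rfl fun z _ => by ring

/-- The wires that are reflected in the walk. -/
def reflectedWires (m n : ℕ) : List (Fin (m + 3) ⊕ Fin n) :=
  extraWire m n 1 :: (List.finRange m).map fun i => blackBoxWires m n (Sum.inl i)

lemma length_reflectedWires (m n : ℕ) : (reflectedWires m n).length = m + 1 := by
  simp [reflectedWires]

lemma nodup_reflectedWires (m n : ℕ) :
    (extraWire m n 0 :: extraWire m n 2 :: reflectedWires m n).Nodup := by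
  have h : ∀ i, extraWire m n i ∉ (List.finRange m).map fun i => blackBoxWires m n (Sum.inl i) := by
    intro i hi
    obtain ⟨j, -, hj⟩ := List.mem_map.mp hi
    exact blackBoxWires_ne_extraWire _ _ hj
  have hne : ∀ {i j : Fin 3}, i ≠ j → extraWire m n i ≠ extraWire m n j := fun hij h' =>
    hij (extraWire_injective m n h')
  rw [reflectedWires, List.nodup_cons, List.nodup_cons, List.nodup_cons, List.mem_cons,
    List.mem_cons, List.mem_cons, not_or, not_or, not_or]
  refine ⟨⟨hne (by decide), hne (by decide), h 0⟩, ⟨hne (by decide), h 2⟩, h 1, ?_⟩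
  exact (List.nodup_finRange m).map fun i j hij =>
    Sum.inl_injective ((blackBoxWires m n).injective hij)

lemma forall_inl_iff_allZero {m n : ℕ} (x : Fin (m + 3) ⊕ Fin n → Fin 2) :
    (∀ i, x (Sum.inl i) = 0) ↔
      AllZero (reflectedWires m n) x ∧ x (extraWire m n 0) = 0 ∧ x (extraWire m n 2) = 0 := by
  rw [forall_inl_iff]
  simp only [AllZero, reflectedWires, List.mem_cons, List.mem_map, List.mem_finRange, true_and,
    forall_eq_or_imp, forall_exists_index, forall_apply_eq_imp_iff, Fin.forall_fin_succ,
    Fin.succ_zero_eq_one, IsEmpty.forall_iff, and_true]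
  tauto

lemma embedZero_mem_zeroSubspace {a n : ℕ} (i : Fin a) (v : (Fin n → Fin 2) → ℂ) :
    embedZero a n v ∈ zeroSubspace (Sum.inl i) := fun _ hx =>
  embedZero_of_not_zero v fun h => hx (h i)

/-- The signal and workspace wires are not in the reflected list. On vectors where both are 0, the
operator is nevertheless the reflection for all m + 3 ancillas. -/
lemma zeroReflection_mulVec {m n : ℕ} {ψ : (Fin (m + 3) ⊕ Fin n → Fin 2) → ℂ}
    (h0 : ψ ∈ zeroSubspace (extraWire m n 0)) (h2 : ψ ∈ zeroSubspace (extraWire m n 2)) :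
    zeroReflection (reflectedWires m n) *ᵥ ψ =
      ψ - (2 : ℂ) • embedZero (m + 3) n fun y => ψ (Sum.elim (fun _ => 0) y) := by
  funext x
  rw [zeroReflection, mulVec_diagonal, Pi.sub_apply, Pi.smul_apply]
  by_cases h : ∀ i, x (Sum.inl i) = 0
  · rw [embedZero_of_zero _ h, if_pos ((forall_inl_iff_allZero x).mp h).1, ← eq_elim_of_zero h,
      smul_eq_mul]
    ring
  · rw [embedZero_of_not_zero _ h, smul_zero, sub_zero]
    have h' := mt (forall_inl_iff_allZero x).mpr h
    split_ifs with hz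
    · have hx : ψ x = 0 := by
        by_cases hx0 : x (extraWire m n 0) = 0
        · exact h2 x fun hx2 => h' ⟨hz, hx0, hx2⟩
        · exact h0 x hx0
      rw [hx, mul_zero]
    · rw [one_mul]

/-- A circuit that encodes a polynomial of the squared shifted operator. -/
theorem exists_polynomial_circuit (m n d : ℕ) {F : ℂ[X]} (hF : F.natDegree ≤ d)
    (hF' : ∀ t : ℝ, 0 ≤ t → t ≤ 4 → ‖F.eval (t : ℂ)‖ < 1) (R R' : unitaryGroup (Fin 2) ℂ) :
    ∃ c : Circuit (Fin m ⊕ Fin n) (Fin (m + 3) ⊕ Fin n),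
      queryCount c ≤ 6 * d + 2 ∧ primitiveCount c ≤ (3 * d + 1) * (240 * (m + 1)) ∧
      ∀ U ∈ unitaryGroup (Fin m ⊕ Fin n → Fin 2) ℂ, ∀ A : QubitOp (Fin n), A.IsHermitian →
        A = (R'.1 0 0 * R.1 0 0) • (1 : QubitOp (Fin n)) + (R'.1 0 1 * R.1 1 0) • ancillaBlock U →
        ancillaBlock (eval U c) = aeval ((4 : ℂ) • (A * A)) F := by
  have hlift : ∀ z : ℂ, ‖z‖ = 1 → ‖(laurentLift d F).eval z‖ < 1 := by
    intro z hz
    have hzz : z * starRingEnd ℂ z = 1 := by rw [Complex.mul_conj']; simp [hz]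
    have h := aeval_laurentLift hF hzz (by rw [mul_comm]; exact hzz)
    rw [coe_aeval_eq_eval, coe_aeval_eq_eval] at h
    -- On the circle 2 - z - 1/z = 2 - 2 Re z runs through [0, 4], the interval on which F is
    -- bounded.
    have hre : 2 - z - starRingEnd ℂ z = ((2 - 2 * z.re : ℝ) : ℂ) := by
      rw [sub_sub, Complex.add_conj]; push_cast; ring
    have hb := abs_le.mp (Complex.abs_re_le_norm z)
    rw [hz] at hb
    rw [h, hre, norm_mul, norm_pow, hz, one_pow, one_mul]
    exact hF' _ (by linarith) (by linarith)
  obtain ⟨P', hP', hPP'⟩ := exists_complement (natDegree_laurentLift_le d F) hlift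
  obtain ⟨l, hl, hl'⟩ := exists_rotations (2 * d) _ _ (natDegree_laurentLift_le d F) hP' hPP'
  set L := reflectedWires m n with hL
  have hlen : L.length = m + 1 := length_reflectedWires m n
  -- The m + 1 controls are split as evenly as possible, the extra one going to the first half. That
  -- half is nonempty even for m = 0.
  set A₀ := L.take ((m + 2) / 2) with hA₀
  set B₀ := L.drop ((m + 2) / 2) with hB₀
  have hAB : A₀ ++ B₀ = L := List.take_append_drop _ _
  have hAl : A₀.length = (m + 2) / 2 := by rw [hA₀, List.length_take, hlen]; omega
  have hBl : B₀.length = m + 1 - (m + 2) / 2 := by rw [hB₀, List.length_drop, hlen]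
  set cw := walkCircuit (shiftCircuit m n R R') A₀ B₀ (extraWire m n 0) (extraWire m n 2) with hcw
  have hcwq : queryCount cw = 2 := by
    simp only [hcw, walkCircuit, queryCount_append, queryCount_multiPhase, queryCount_adjoint,
      shiftCircuit, queryCount_singleGate]
    rfl
  -- Two phases of at most 56(m + 2) + 2 gates, four rotations in V and V†, and one Z give 112m +
  -- 233.
  have hcwp : primitiveCount cw ≤ 235 * (m + 1) := by
    have h1 := primitiveCount_multiPhase_le (Q := Fin m ⊕ Fin n) A₀ B₀ (extraWire m n 0)
      (extraWire m n 2)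
    have h2 : primitiveCount ([.controlledQuery false (controlledBlackBoxWires m n)] :
      Circuit (Fin m ⊕ Fin n) (Fin (m + 3) ⊕ Fin n)) = 0 := rfl
    simp only [hcw, walkCircuit, primitiveCount_append, primitiveCount_adjoint,
      shiftCircuit, primitiveCount_singleGate, h2]
    omega
  refine ⟨interleave cw (extraWire m n 0) l ++ undo cw (extraWire m n 0) d, ?_, ?_, ?_⟩
  · have h1 : ∀ l, queryCount (interleave cw (extraWire m n 0) l) = 2 * l.length := by
      intro l
      induction l with
      | nil => rfl
      | cons r l ih =>
        simp only [interleave, queryCount_append, ih, hcwq, queryCount_singleGate,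
          List.length_cons]
        ring
    have h2 : ∀ d, queryCount (undo cw (extraWire m n 0) d) = 2 * d := by
      intro d
      induction d with
      | zero => rfl
      | succ d ih =>
        simp only [undo, queryCount_append, ih, hcwq, queryCount_singleGate, queryCount_adjoint]
        ring
    rw [queryCount_append, h1, h2, hl]
    omega
  · have h1 : ∀ l, primitiveCount (interleave cw (extraWire m n 0) l) ≤
        l.length * (240 * (m + 1)) := by
      intro l
      induction l with
      | nil => exact Nat.zero_le _
      | cons r l ih =>
        simp only [interleave, primitiveCount_append, primitiveCount_singleGate,
          List.length_cons, add_mul]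
        omega
    have h2 : ∀ d, primitiveCount (undo cw (extraWire m n 0) d) ≤ d * (240 * (m + 1)) := by
      intro d
      induction d with
      | zero => exact Nat.zero_le _
      | succ d ih =>
        simp only [undo, primitiveCount_append, primitiveCount_singleGate,
          primitiveCount_adjoint, add_mul]
        omega
    have h3 := h1 l
    rw [hl] at h3
    rw [primitiveCount_append]
    calc _ ≤ (2 * d + 1) * (240 * (m + 1)) + d * (240 * (m + 1)) := add_le_add h3 (h2 d)
      _ = _ := by ring
  · intro U hU A hA hAdef
    set V := eval U (shiftCircuit m n R R') with hVdef
    have hVU : V ∈ unitaryGroup _ ℂ := Circuit.eval_mem_unitaryGroup hU _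
    have hblock : ancillaBlock V = A := by rw [hAdef, hVdef, ancillaBlock_shiftCircuit]
    have hblock' : ancillaBlock Vᴴ = A := by rw [ancillaBlock_conjTranspose, hblock, hA.eq]
    have hav0 := shiftCircuit_avoids m n R R' (i := 0) (by decide)
    have hav2 := shiftCircuit_avoids m n R R' (i := 2) (by decide)
    have hwalk : ∀ v, (2 - walkOp L V - (walkOp L V)ᴴ) *ᵥ embedZero (m + 3) n v =
        embedZero (m + 3) n (((4 : ℂ) • (A * A)) *ᵥ v) := by
      refine walkOp_mulVec_embedZero (mem_unitaryGroup_iff'.mp hVU) ?_ ?_ ?_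
      · intro v
        rw [zeroReflection_mulVec (embedZero_mem_zeroSubspace _ v) (embedZero_mem_zeroSubspace _ v)]
        simp only [embedZero_elim]
        module
      · intro v
        rw [zeroReflection_mulVec ((hav0.eval U).1 _ (embedZero_mem_zeroSubspace _ v))
          ((hav2.eval U).1 _ (embedZero_mem_zeroSubspace _ v)), ← hblock]
        simp only [← ancillaBlock_mulVec]
        rfl
      · intro v
        have e0 := (hav0.adjoint.eval U).1 _ (embedZero_mem_zeroSubspace (Fin.natAdd m 0) v)
        have e2 := (hav2.adjoint.eval U).1 _ (embedZero_mem_zeroSubspace (Fin.natAdd m 2) v)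
        rw [Circuit.eval_adjoint] at e0 e2
        rw [zeroReflection_mulVec e0 e2, ← hblock']
        simp only [← ancillaBlock_mulVec]
        rfl
    have hctrl : ControlsOperator U cw (extraWire m n 0) (walkOp L V) := by
      have := controlsOperator_walkCircuit hU (V := shiftCircuit m n R R') (A := A₀) (B := B₀)
        (c := extraWire m n 0) (w := extraWire m n 2) hav0 (by rw [hAB]; exact nodup_reflectedWires m n)
        (by rw [← List.length_pos_iff, hAl]; omega) (by omega) (by omega)
      rwa [hAB] at this
    have hWU := walkOp_mem_unitaryGroup L hVU
    have hW1 : walkOp L V * (walkOp L V)ᴴ = 1 := mem_unitaryGroup_iff.mp hWU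
    have hW2 : (walkOp L V)ᴴ * walkOp L V = 1 := mem_unitaryGroup_iff'.mp hWU
    have hctrl' := hctrl.adjoint hU hW1 (by
      intro φ hφ
      have hN := fun ψ => zeroReflection_mulVec_mem L (c := extraWire m n 0) (φ := ψ)
      have e1 := (hav0.adjoint.eval U).1
      rw [Circuit.eval_adjoint] at e1
      rw [walkOp_conjTranspose, neg_mulVec, ← mulVec_mulVec, ← mulVec_mulVec, ← mulVec_mulVec]
      exact Submodule.neg_mem _ (hN _ (e1 _ (hN _ ((hav0.eval U).1 _ hφ)))))
    have hmem : ∀ p v, aeval (walkOp L V) p *ᵥ embedZero (m + 3) n v ∈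
        zeroSubspace (extraWire m n 0) := fun p v =>
      aeval_mulVec_mem hctrl.mem p (embedZero_mem_zeroSubspace _ v)
    refine eq_of_forall_mulVec fun v => funext fun y => ?_
    rw [ancillaBlock_mulVec]
    change act U _ (embedZero (m + 3) n v) _ = _
    have hinv : (walkOp L V)ᴴ ^ d * walkOp L V ^ d = 1 := by
      have hcomm : Commute (walkOp L V)ᴴ (walkOp L V) := hW2.trans hW1.symm
      rw [← hcomm.mul_pow, hW2, one_pow]
    -- The inverse power cancels Wᵈ on the 0-branch, leaving F(2 - W - W†), hence F(4A²) on the main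
    -- register. The complementary polynomial sits on the 1-branch and does not enter the ancilla
    -- block.
    rw [act_append, hctrl.act_interleave l (embedZero_mem_zeroSubspace _ v), hl',
      hctrl'.act_undo d (hmem _ v) (hmem _ v), aeval_laurentLift hF hW1 hW2, mulVec_mulVec,
      ← Matrix.mul_assoc, hinv, Matrix.one_mul, aeval_mulVec_intertwine hwalk, Pi.add_apply,
      embedZero_elim, rot_pauliX, hmem _ v _ (by
        rw [Function.update_self]; exact (by decide : (0 : Fin 2) + 1 ≠ 0)), add_zero]

end

end Quantum

namespace Quantum

noncomputable section

open Matrix Polynomial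

/-! ### Operators diagonal in the eigenbasis of H -/

section spectral

variable {ι : Type} [Fintype ι] [DecidableEq ι]

lemma norm_le_of_apply_orthonormalBasis {E : Type*} [NormedAddCommGroup E]
    [InnerProductSpace ℂ E] (b : OrthonormalBasis ι ℂ E) (T : E →L[ℂ] E) (c : ι → ℂ)
    (hT : ∀ i, T (b i) = c i • b i) {δ : ℝ} (hδ : 0 ≤ δ) (hc : ∀ i, ‖c i‖ ≤ δ) : ‖T‖ ≤ δ := by
  refine T.opNorm_le_bound hδ fun x => ?_
  have hrepr : ∀ i, b.repr (T x) i = c i * b.repr x i := by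
    intro i
    conv_lhs => rw [← b.sum_repr x, map_sum, map_sum]
    simp only [map_smul, hT]
    rw [WithLp.ofLp_sum, Finset.sum_apply, Finset.sum_eq_single i]
    · simp [mul_comm]
    · intro j _ hj
      simp [hj.symm]
    · simp
  rw [← b.repr.norm_map (T x), ← b.repr.norm_map x]
  refine le_of_sq_le_sq ?_ (by positivity)
  rw [mul_pow, EuclideanSpace.norm_sq_eq, EuclideanSpace.norm_sq_eq, Finset.mul_sum]
  refine Finset.sum_le_sum fun i _ => ?_
  rw [hrepr, norm_mul, mul_pow]
  gcongr
  exact hc i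

lemma aeval_mulVec_of_eigenvector {M : Matrix ι ι ℂ} {v : ι → ℂ} {t : ℂ} (h : M *ᵥ v = t • v)
    (p : ℂ[X]) : aeval M p *ᵥ v = p.eval t • v := by
  induction p using Polynomial.induction_on' with
  | add p q hp hq => rw [map_add, add_mulVec, hp, hq, eval_add, add_smul]
  | monomial n a =>
    rw [aeval_monomial, ← Algebra.smul_def, smul_mulVec, eval_monomial, mul_smul]
    congr 1
    induction n with
    | zero => simp
    | succ n ih => rw [pow_succ', ← mulVec_mulVec, ih, mulVec_smul, h, smul_smul, pow_succ]

/-- A basis vector for a different eigenvalue is orthogonal to the eigenspace, by symmetry of H. -/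
lemma eigenProjection_mulVec_eigenvectorBasis {H : Matrix ι ι ℂ} (hH : H.IsHermitian) (lam : ℝ)
    (i : ι) :
    toEuclideanCLM (n := ι) (𝕜 := ℂ) (eigenProjection H lam) (hH.eigenvectorBasis i) =
      if hH.eigenvalues i = lam then hH.eigenvectorBasis i else 0 := by
  have hb : toEuclideanLin H (hH.eigenvectorBasis i) =
      (hH.eigenvalues i : ℂ) • hH.eigenvectorBasis i := by
    refine WithLp.ofLp_injective 2 ?_
    rw [ofLp_toLpLin, toLin'_apply, hH.mulVec_eigenvectorBasis]
    rfl
  rw [eigenProjection, StarAlgEquiv.apply_symm_apply]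
  split_ifs with h
  · refine Submodule.eq_starProjection_of_mem_of_inner_eq_zero ?_ (by simp)
    rw [Module.End.mem_eigenspace_iff, hb, h]
  · refine Submodule.eq_starProjection_of_mem_of_inner_eq_zero (Submodule.zero_mem _) ?_
    intro w hw
    rw [Module.End.mem_eigenspace_iff] at hw
    have hsym := (isSymmetric_toEuclideanLin_iff.mpr hH) (hH.eigenvectorBasis i) w
    rw [hb, hw, inner_smul_left, inner_smul_right, Complex.conj_ofReal] at hsym
    rw [sub_zero]
    by_contra hne
    exact h (by exact_mod_cast mul_right_cancel₀ hne hsym)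

/-- Both operators are diagonal in one orthonormal basis, so the operator norm reduces to scalar
errors at the eigenvalues. -/
lemma opNorm_reflection_sub_le {H G : Matrix ι ι ℂ} (hH : H.IsHermitian) (lam : ℝ) (e : ℂ)
    (g : ι → ℂ) (hG : ∀ i, G *ᵥ ⇑(hH.eigenvectorBasis i) = g i • ⇑(hH.eigenvectorBasis i))
    {δ : ℝ} (hδ : 0 ≤ δ) (h1 : ∀ i, hH.eigenvalues i = lam → ‖1 - g i‖ ≤ δ)
    (h2 : ∀ i, hH.eigenvalues i ≠ lam → ‖e - g i‖ ≤ δ) :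
    opNorm (eigenProjection H lam + e • (1 - eigenProjection H lam) - G) ≤ δ := by
  refine norm_le_of_apply_orthonormalBasis hH.eigenvectorBasis _
    (fun i => (if hH.eigenvalues i = lam then 1 else e) - g i) (fun i => ?_) hδ (fun i => ?_)
  · have hG' : toEuclideanCLM (n := ι) (𝕜 := ℂ) G (hH.eigenvectorBasis i) =
        g i • hH.eigenvectorBasis i := by
      refine WithLp.ofLp_injective 2 ?_
      rw [ofLp_toEuclideanCLM, hG]
      rfl
    rw [map_sub, map_add, map_smul, map_sub, map_one]
    simp only [_root_.sub_apply, _root_.add_apply, _root_.smul_apply, one_apply_eq_self]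
    rw [hG', eigenProjection_mulVec_eigenvectorBasis]
    split_ifs <;> module
  · split_ifs with h
    · exact h1 i h
    · exact h2 i h

lemma eigenvalues_mem_spectrum {H : Matrix ι ι ℂ} (hH : H.IsHermitian) (i : ι) :
    (hH.eigenvalues i : ℂ) ∈ spectrum ℂ H :=
  spectrum.algebraMap_mem ℂ (hH.eigenvalues_mem_spectrum_real i)

lemma sum_norm_sq_mulVec {U : Matrix ι ι ℂ} (hU : U ∈ unitaryGroup ι ℂ) (ψ : ι → ℂ) :
    ∑ i, ‖(U *ᵥ ψ) i‖ ^ 2 = ∑ i, ‖ψ i‖ ^ 2 := by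
  have h : ∀ φ : ι → ℂ, ((∑ i, ‖φ i‖ ^ 2 : ℝ) : ℂ) = star φ ⬝ᵥ φ := by
    intro φ
    rw [dotProduct, Complex.ofReal_sum]
    refine Finset.sum_congr rfl fun i _ => ?_
    rw [Complex.ofReal_pow, ← Complex.conj_mul']
    rfl
  have : ((∑ i, ‖(U *ᵥ ψ) i‖ ^ 2 : ℝ) : ℂ) = ((∑ i, ‖ψ i‖ ^ 2 : ℝ) : ℂ) := by
    rw [h, h, star_mulVec, dotProduct_mulVec, vecMul_vecMul, ← star_eq_conjTranspose,
      mem_unitaryGroup_iff'.mp hU, vecMul_one]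
  exact_mod_cast this

end spectral

/-! ### Consequences of an exact block-encoding -/

section blockEncoding

lemma sum_norm_sq_embedZero {a n : ℕ} (v : (Fin n → Fin 2) → ℂ) :
    ∑ x, ‖embedZero a n v x‖ ^ 2 = ∑ y, ‖v y‖ ^ 2 := by
  have h := sum_mul_embedZero (fun x => starRingEnd ℂ (embedZero a n v x)) v
  simp only [embedZero_elim, Complex.conj_mul'] at h
  exact_mod_cast h

/-- The embedding and U preserve the norm; passing to the block only discards coordinates. -/
lemma sum_norm_sq_ancillaBlock_le {a n : ℕ} {U : QubitOp (Fin a ⊕ Fin n)}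
    (hU : U ∈ unitaryGroup (Fin a ⊕ Fin n → Fin 2) ℂ) (v : (Fin n → Fin 2) → ℂ) :
    ∑ y, ‖(ancillaBlock U *ᵥ v) y‖ ^ 2 ≤ ∑ y, ‖v y‖ ^ 2 := by
  rw [← sum_norm_sq_embedZero (a := a) v, ← sum_norm_sq_mulVec hU]
  simp only [ancillaBlock_mulVec]
  have hinj : Function.Injective (fun y : Fin n → Fin 2 =>
      (Sum.elim (fun _ => 0) y : Fin a ⊕ Fin n → Fin 2)) := by
    intro y y' h
    have := congrArg (· ∘ Sum.inr) h
    simpa using this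
  rw [← Finset.sum_image (f := fun x => ‖(U *ᵥ embedZero a n v) x‖ ^ 2) (s := Finset.univ)
    (g := fun y : Fin n → Fin 2 => (Sum.elim (fun _ => 0) y : Fin a ⊕ Fin n → Fin 2))
    hinj.injOn]
  exact Finset.sum_le_sum_of_subset_of_nonneg (Finset.subset_univ _) fun _ _ _ => by positivity

lemma IsBlockEncoding.eq_smul {n a : ℕ} {α : ℝ} {U : QubitOp (Fin a ⊕ Fin n)}
    {H : QubitOp (Fin n)} (h : IsBlockEncoding α a 0 U H) : H = (α : ℂ) • ancillaBlock U := by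
  have h0 := norm_le_zero_iff.mp h.2
  rw [EmbeddingLike.map_eq_zero_iff] at h0
  exact sub_eq_zero.mp h0

/-- H is α times a contraction. -/
lemma IsBlockEncoding.abs_eigenvalue_le {n a : ℕ} {α : ℝ} (hα : 0 < α)
    {U : QubitOp (Fin a ⊕ Fin n)} {H : QubitOp (Fin n)} (h : IsBlockEncoding α a 0 U H) {μ : ℝ}
    {v : (Fin n → Fin 2) → ℂ} (hv : v ≠ 0) (hμ : H *ᵥ v = (μ : ℂ) • v) : |μ| ≤ α := by
  have hle := sum_norm_sq_ancillaBlock_le h.1 v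
  have hb : ∀ y, α ^ 2 * ‖(ancillaBlock U *ᵥ v) y‖ ^ 2 = μ ^ 2 * ‖v y‖ ^ 2 := by
    intro y
    have := congrFun hμ y
    rw [h.eq_smul, smul_mulVec, Pi.smul_apply, Pi.smul_apply, smul_eq_mul, smul_eq_mul] at this
    have := congrArg (fun z => ‖z‖ ^ 2) this
    simpa only [norm_mul, mul_pow, Complex.norm_real, Real.norm_eq_abs, sq_abs] using this
  have hpos : 0 < ∑ y, ‖v y‖ ^ 2 := by
    obtain ⟨y, hy⟩ := Function.ne_iff.mp hv
    refine Finset.sum_pos' (fun _ _ => by positivity) ⟨y, Finset.mem_univ _, ?_⟩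
    have := norm_pos_iff.mpr hy
    positivity
  have h2 : μ ^ 2 * ∑ y, ‖v y‖ ^ 2 ≤ α ^ 2 * ∑ y, ‖v y‖ ^ 2 := by
    rw [Finset.mul_sum, ← Finset.sum_congr rfl fun y _ => hb y, ← Finset.mul_sum]
    gcongr
  exact abs_le_of_sq_le_sq (le_of_mul_le_mul_right h2 hpos) hα.le

lemma ofLp_eigenvectorBasis_ne_zero {ι : Type} [Fintype ι] [DecidableEq ι] {H : Matrix ι ι ℂ}
    (hH : H.IsHermitian) (i : ι) : (⇑(hH.eigenvectorBasis i) : ι → ℂ) ≠ 0 := fun h =>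
  hH.eigenvectorBasis.orthonormal.ne_zero i (WithLp.ofLp_injective 2 h)

lemma IsBlockEncoding.abs_eigenvalues_le {n a : ℕ} {α : ℝ} (hα : 0 < α)
    {U : QubitOp (Fin a ⊕ Fin n)} {H : QubitOp (Fin n)} (h : IsBlockEncoding α a 0 U H)
    (hH : H.IsHermitian) (i : Fin n → Fin 2) : |hH.eigenvalues i| ≤ α :=
  h.abs_eigenvalue_le hα (ofLp_eigenvectorBasis_ne_zero hH i) (hH.mulVec_eigenvectorBasis i)

lemma IsBlockEncoding.abs_le_of_hasEigenvalue {n a : ℕ} {α : ℝ} (hα : 0 < α)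
    {U : QubitOp (Fin a ⊕ Fin n)} {H : QubitOp (Fin n)} (h : IsBlockEncoding α a 0 U H) {lam : ℝ}
    (hlam : Module.End.HasEigenvalue (toEuclideanLin H) (lam : ℂ)) : |lam| ≤ α := by
  obtain ⟨v, hv⟩ := hlam.exists_hasEigenvector
  refine h.abs_eigenvalue_le hα (v := WithLp.ofLp v) (fun h0 => hv.2 (WithLp.ofLp_injective 2 h0)) ?_
  rw [← toLin'_apply, ← ofLp_toLpLin 2 2, hv.apply_eq_smul]
  rfl

lemma IsGappedEigenvalue.gap_le {ι : Type} [Fintype ι] [DecidableEq ι] {H : Matrix ι ι ℂ}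
    {lam gap : ℝ} (h : IsGappedEigenvalue H lam gap) (hH : H.IsHermitian) {i : ι}
    (hi : hH.eigenvalues i ≠ lam) : gap ≤ |hH.eigenvalues i - lam| := by
  have := h.2 _ (eigenvalues_mem_spectrum hH i) (by exact_mod_cast hi)
  rwa [← Complex.ofReal_sub, Complex.norm_real] at this

end blockEncoding

/-! ### Choice of rotations, polynomial and degree -/

/-- Rotations for the linear combination of `1` and the black box that encodes `(H - lam) / β`. -/
lemma exists_shift_rotations {α : ℝ} (hα : 0 < α) (lam : ℝ) :
    ∃ R R' : unitaryGroup (Fin 2) ℂ,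
      R'.1 0 0 * R.1 0 0 = ((-lam / (α + |lam|) : ℝ) : ℂ) ∧
      R'.1 0 1 * R.1 1 0 = ((α / (α + |lam|) : ℝ) : ℂ) := by
  have hβ : 0 < α + |lam| := by positivity
  set c := Real.sqrt (|lam| / (α + |lam|)) with hc
  set s := Real.sqrt (α / (α + |lam|)) with hs
  have hc2 : c ^ 2 = |lam| / (α + |lam|) := Real.sq_sqrt (by positivity)
  have hs2 : s ^ 2 = α / (α + |lam|) := Real.sq_sqrt (by positivity)
  have hcs : c ^ 2 + s ^ 2 = 1 := by
    rw [hc2, hs2, ← add_div, add_comm, div_self hβ.ne']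
  -- The weights |λ|/β and α/β are c² and s² with c² + s² = 1. The sign of -λ is put into the second
  -- rotation.
  obtain ⟨σ, hσ, hσl⟩ : ∃ σ : ℝ, |σ| = 1 ∧ σ * |lam| = -lam := by
    rcases le_total 0 lam with h | h
    · exact ⟨-1, by simp, by rw [abs_of_nonneg h]; ring⟩
    · exact ⟨1, by simp, by rw [abs_of_nonpos h]; ring⟩
  refine ⟨⟨columnUnitary c s, columnUnitary_mem ?_⟩,
    ⟨columnUnitary (σ * c : ℝ) (-s : ℝ), columnUnitary_mem ?_⟩, ?_, ?_⟩
  · rw [Complex.norm_real, Complex.norm_real, Real.norm_eq_abs, Real.norm_eq_abs, sq_abs, sq_abs,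
      hcs]
  · rw [Complex.norm_real, Complex.norm_real, Real.norm_eq_abs, Real.norm_eq_abs, abs_mul, hσ,
      one_mul, abs_neg, sq_abs, sq_abs, hcs]
  · change ((σ * c : ℝ) : ℂ) * (c : ℂ) = _
    rw [← Complex.ofReal_mul, mul_assoc, ← sq, hc2, ← hσl]
    congr 1; ring
  · change -(starRingEnd ℂ ((-s : ℝ) : ℂ)) * (s : ℂ) = _
    rw [Complex.conj_ofReal, Complex.ofReal_neg, neg_neg, ← Complex.ofReal_mul, ← sq, hs2]

/-- The target polynomial: nearly the `θ`-reflection, as a function of the squared distance from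
the eigenvalue. -/
def reflectionPoly (σ : ℝ) (e : ℂ) (M k : ℕ) : ℂ[X] :=
  C (σ : ℂ) * (C e + C (1 - e) * (filterPoly M k).map Complex.ofRealHom)

lemma natDegree_reflectionPoly_le (σ : ℝ) (e : ℂ) (M k : ℕ) :
    (reflectionPoly σ e M k).natDegree ≤ 2 * k * M := by
  refine (natDegree_C_mul_le _ _).trans ((natDegree_add_le _ _).trans (max_le ?_ ?_))
  · rw [natDegree_C]; exact Nat.zero_le _
  · exact (natDegree_C_mul_le _ _).trans (natDegree_map_le.trans (natDegree_filterPoly_le M k))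

lemma eval_reflectionPoly (σ : ℝ) (e : ℂ) (M k : ℕ) (t : ℝ) :
    (reflectionPoly σ e M k).eval (t : ℂ) =
      σ * (e + (1 - e) * (((filterPoly M k).eval t : ℝ) : ℂ)) := by
  rw [reflectionPoly, eval_mul, eval_add, eval_mul, eval_C, eval_C, eval_C, eval_map,
    ← Complex.ofRealHom_eq_coe t, eval₂_at_apply]
  rfl

/-- Since e + (1 - e)f = (1 - f)e + f with f in [0, 1], this is a convex combination of points of
modulus 1. The factor σ < 1 gives the strict inequality that Fejér–Riesz requires. -/
lemma norm_eval_reflectionPoly_lt {σ : ℝ} (h0 : 0 ≤ σ) (h1 : σ < 1) {e : ℂ} (he : ‖e‖ = 1)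
    (M k : ℕ) {t : ℝ} (ht0 : 0 ≤ t) (ht4 : t ≤ 4) :
    ‖(reflectionPoly σ e M k).eval (t : ℂ)‖ < 1 := by
  have hx : |Real.sqrt t / 2| ≤ 1 := by
    rw [abs_of_nonneg (by positivity), div_le_one (by norm_num)]
    exact Real.sqrt_le_iff.mpr ⟨by norm_num, by linarith⟩
  have ht : 4 * (Real.sqrt t / 2) ^ 2 = t := by
    rw [div_pow, Real.sq_sqrt ht0]; ring
  have hf1 := eval_filterPoly_le_one M k hx
  rw [ht] at hf1
  have hf0 := eval_filterPoly_nonneg M k t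
  rw [eval_reflectionPoly, norm_mul, Complex.norm_real, Real.norm_of_nonneg h0]
  set f := (filterPoly M k).eval t
  have hle : ‖e + (1 - e) * (f : ℂ)‖ ≤ 1 := by
    have : e + (1 - e) * (f : ℂ) = e * ((1 - f : ℝ) : ℂ) + (f : ℂ) := by push_cast; ring
    rw [this]
    refine (norm_add_le _ _).trans ?_
    rw [norm_mul, he, Complex.norm_real, Complex.norm_real, Real.norm_of_nonneg hf0,
      Real.norm_of_nonneg (by linarith)]
    linarith
  exact (mul_le_of_le_one_right h0 hle).trans_lt h1

/-- The error is (1 - σ)e - σf(1 - e) with |1 - e| ≤ 2 and f ≤ 4⁻ᵏ. -/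
lemma norm_sub_eval_reflectionPoly_le {σ : ℝ} (h0 : 0 ≤ σ) (h1 : σ ≤ 1) {e : ℂ} (he : ‖e‖ = 1)
    (M k : ℕ) {x : ℝ} (hx : |x| ≤ 1) (h2 : 2 ≤ (2 * M + 1) * |x|) :
    ‖e - (reflectionPoly σ e M k).eval ((4 * x ^ 2 : ℝ) : ℂ)‖ ≤ (1 - σ) + 2 * (1 / 4) ^ k := by
  have hf := eval_filterPoly_le M k hx h2
  have hf0 := eval_filterPoly_nonneg M k (4 * x ^ 2)
  rw [eval_reflectionPoly]
  set f := (filterPoly M k).eval (4 * x ^ 2)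
  have : e - σ * (e + (1 - e) * (f : ℂ)) = ((1 - σ : ℝ) : ℂ) * e - ((σ * f : ℝ) : ℂ) * (1 - e) := by
    push_cast; ring
  rw [this]
  refine (norm_sub_le _ _).trans ?_
  rw [norm_mul, norm_mul, he, Complex.norm_real, Complex.norm_real,
    Real.norm_of_nonneg (by linarith), Real.norm_of_nonneg (by positivity)]
  have h3 : ‖(1 : ℂ) - e‖ ≤ 2 := by
    refine (norm_sub_le _ _).trans ?_
    rw [he, norm_one]; norm_num
  have h4 : σ * f ≤ (1 / 4) ^ k := (mul_le_of_le_one_left hf0 h1).trans hf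
  have h5 : σ * f * ‖(1 : ℂ) - e‖ ≤ (1 / 4) ^ k * 2 := by gcongr
  linarith

lemma quarter_pow_ceil_log_le {ε : ℝ} (hε : 0 < ε) : (1 / 4 : ℝ) ^ ⌈Real.log (4 / ε)⌉₊ ≤ ε / 4 := by
  have h1 : (1 / 4 : ℝ) ≤ Real.exp (-1) := by
    rw [Real.exp_neg, one_div]
    exact inv_anti₀ (Real.exp_pos 1) (by linarith [Real.exp_one_lt_d9])
  calc (1 / 4 : ℝ) ^ ⌈Real.log (4 / ε)⌉₊ ≤ Real.exp (-1) ^ ⌈Real.log (4 / ε)⌉₊ := by gcongr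
    _ = Real.exp (-(⌈Real.log (4 / ε)⌉₊ : ℝ)) := by rw [← Real.exp_nat_mul]; ring_nf
    _ ≤ Real.exp (-Real.log (4 / ε)) := by
      gcongr
      exact Nat.le_ceil _
    _ = ε / 4 := by rw [Real.exp_neg, Real.exp_log (by positivity), inv_div]

/-- The ceilings are absorbed into the main terms: gap ≤ 2α gives ⌈2α/gap⌉ ≤ 4α/gap. The additive
constant in log(4/ε) + 1, below log(1/ε) + 3, is absorbed because log(1/ε) ≥ log(1/ε₀) > 0; this is
the dependence on ε₀. Positivity of the degree later absorbs the additive terms in the gate counts.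
-/
lemma degree_bound {ε₀ α gap ε : ℝ} (hε₀ : 0 < ε₀) (hε₀' : ε₀ < 1) (hgap : 0 < gap)
    (h2 : gap ≤ 2 * α) (hε : 0 < ε) (hεε₀ : ε ≤ ε₀) :
    1 ≤ 2 * ⌈Real.log (4 / ε)⌉₊ * ⌈2 * α / gap⌉₊ ∧
    ((2 * ⌈Real.log (4 / ε)⌉₊ * ⌈2 * α / gap⌉₊ : ℕ) : ℝ) ≤
      8 * (1 + 3 / Real.log (1 / ε₀)) * (α / gap) * Real.log (1 / ε) := by
  have hα : 0 < α := by linarith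
  have hL0 : 0 < Real.log (1 / ε₀) := Real.log_pos (by rw [lt_div_iff₀ hε₀]; linarith)
  have hL : Real.log (1 / ε₀) ≤ Real.log (1 / ε) :=
    Real.log_le_log (by positivity) (one_div_le_one_div_of_le hε hεε₀)
  have hLε : 0 < Real.log (1 / ε) := hL0.trans_le hL
  have hlog : Real.log (4 / ε) = 2 * Real.log 2 + Real.log (1 / ε) := by
    rw [show (4 : ℝ) / ε = 2 ^ 2 * (1 / ε) by ring, Real.log_mul (by norm_num) (by positivity),
      Real.log_pow]
    norm_num
  have hlog2 := Real.log_two_lt_d9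
  have hlog2' := Real.log_two_gt_d9
  have hk : (⌈Real.log (4 / ε)⌉₊ : ℝ) < Real.log (4 / ε) + 1 := Nat.ceil_lt_add_one (by linarith)
  have hM : (⌈2 * α / gap⌉₊ : ℝ) < 2 * α / gap + 1 := Nat.ceil_lt_add_one (by positivity)
  have h1 : 1 ≤ 2 * α / gap := by rw [le_div_iff₀ hgap]; linarith
  have hk' : (⌈Real.log (4 / ε)⌉₊ : ℝ) ≤ (1 + 3 / Real.log (1 / ε₀)) * Real.log (1 / ε) := by
    have : 3 ≤ 3 / Real.log (1 / ε₀) * Real.log (1 / ε) := by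
      rw [div_mul_eq_mul_div, le_div_iff₀ hL0]
      linarith
    linarith
  have hM' : (⌈2 * α / gap⌉₊ : ℝ) ≤ 4 * (α / gap) := by
    have : 2 * α / gap = 2 * (α / gap) := by ring
    linarith
  constructor
  · have hk0 : 0 < ⌈Real.log (4 / ε)⌉₊ := Nat.ceil_pos.mpr (by linarith)
    have hM0 : 0 < ⌈2 * α / gap⌉₊ := Nat.ceil_pos.mpr (by positivity)
    have : 0 < 2 * ⌈Real.log (4 / ε)⌉₊ * ⌈2 * α / gap⌉₊ := by positivity
    omega
  · push_cast
    calc 2 * (⌈Real.log (4 / ε)⌉₊ : ℝ) * ⌈2 * α / gap⌉₊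
        ≤ 2 * ((1 + 3 / Real.log (1 / ε₀)) * Real.log (1 / ε)) * (4 * (α / gap)) := by gcongr
      _ = _ := by ring

/-- If the gap exceeds the diameter of the interval of possible eigenvalues, then the reflection
is trivial. -/
lemma isBlockEncoding_one {m n : ℕ} {α lam gap ε : ℝ} (hα : 0 < α) (hgap : 2 * α < gap)
    (hε : 0 < ε) (e : ℂ) {H : QubitOp (Fin n)} {U : QubitOp (Fin m ⊕ Fin n)} (hH : H.IsHermitian)
    (hU : IsBlockEncoding α m 0 U H) (hlam : IsGappedEigenvalue H lam gap) :
    IsBlockEncoding 1 (m + 3) ε 1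
      (eigenProjection H lam + e • (1 - eigenProjection H lam)) := by
  refine ⟨one_mem _, ?_⟩
  rw [Complex.ofReal_one, one_smul]
  have hall : ∀ i, hH.eigenvalues i = lam := by
    intro i
    by_contra hi
    have h1 := hlam.gap_le hH hi
    have h2 := hU.abs_eigenvalues_le hα hH i
    have h3 := hU.abs_le_of_hasEigenvalue hα hlam.1
    linarith [abs_sub (hH.eigenvalues i) lam]
  refine opNorm_reflection_sub_le hH lam e (fun _ => 1) (fun i => ?_) hε.le
    (fun i _ => by simpa using hε.le) (fun i hi => (hi (hall i)).elim)
  have : ancillaBlock (1 : QubitOp (Fin (m + 3) ⊕ Fin n)) = 1 := by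
    refine eq_of_forall_mulVec fun v => funext fun y => ?_
    rw [ancillaBlock_mulVec, one_mulVec, one_mulVec, embedZero_elim]
  rw [this, one_mulVec, one_smul]

end

end Quantum

/-! ### Assembly of the main theorem -/

theorem mainTheorem6 (ε₀ : ℝ) (hε₀ : 0 < ε₀) (hε₀' : ε₀ < 1) :
    ∃ C : ℝ, 0 < C ∧
      ∀ (n m : ℕ) (α lam gap θ ε : ℝ), 0 < α → 0 < gap → 0 < ε → ε ≤ ε₀ →
        ∃ c : Quantum.Circuit (Fin m ⊕ Fin n) (Fin (m + 3) ⊕ Fin n),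
          (Quantum.Circuit.queryCount c : ℝ) ≤ C * (α / gap) * Real.log (1 / ε) ∧
          (Quantum.Circuit.primitiveCount c : ℝ) ≤
            C * (((m : ℝ) + 1) * α / gap) * Real.log (1 / ε) ∧
          ∀ (H : Quantum.QubitOp (Fin n)) (U : Quantum.QubitOp (Fin m ⊕ Fin n)),
            H.IsHermitian →
            Quantum.IsBlockEncoding α m 0 U H →
            Quantum.IsGappedEigenvalue H lam gap →
              Quantum.IsBlockEncoding 1 (m + 3) ε (Quantum.Circuit.eval U c)
                (Quantum.eigenProjection H lam +
                  Complex.exp (θ * Complex.I) • (1 - Quantum.eigenProjection H lam)) := by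
  have hL0 : 0 < Real.log (1 / ε₀) := Real.log_pos (by rw [lt_div_iff₀ hε₀]; linarith)
  -- As d ≥ 1, the primitive count is at most 4d · 240(m + 1) = 960(m + 1)d, and 6d + 2 queries fit
  -- easily.
  refine ⟨960 * (8 * (1 + 3 / Real.log (1 / ε₀))), by positivity, ?_⟩
  intro n m α lam gap θ ε hα hgap hε hεε₀
  have hLε : 0 < Real.log (1 / ε) := Real.log_pos (by rw [lt_div_iff₀ hε]; linarith)
  rcases lt_or_ge (2 * α) gap with hlarge | hsmall
  · refine ⟨[], ?_, ?_, fun H U hH hU hlam => Quantum.isBlockEncoding_one hα hlarge hε _ hH hU hlam⟩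
    · rw [show Quantum.Circuit.queryCount
        ([] : Quantum.Circuit (Fin m ⊕ Fin n) (Fin (m + 3) ⊕ Fin n)) = 0 from rfl, Nat.cast_zero]
      positivity
    · rw [show Quantum.Circuit.primitiveCount
        ([] : Quantum.Circuit (Fin m ⊕ Fin n) (Fin (m + 3) ⊕ Fin n)) = 0 from rfl, Nat.cast_zero]
      positivity
  obtain ⟨hd1, hd⟩ := Quantum.degree_bound hε₀ hε₀' hgap hsmall hε hεε₀
  have hquarter := Quantum.quarter_pow_ceil_log_le hε
  have hMle : 2 * α / gap ≤ ⌈2 * α / gap⌉₊ := Nat.le_ceil _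
  set k := ⌈Real.log (4 / ε)⌉₊
  set M := ⌈2 * α / gap⌉₊
  set d := 2 * k * M
  set e := Complex.exp (θ * Complex.I) with he
  have he1 : ‖e‖ = 1 := Complex.norm_exp_ofReal_mul_I θ
  obtain ⟨R, R', hR1, hR2⟩ := Quantum.exists_shift_rotations hα lam
  -- The scale 1 - ε/2 spends half of the error budget on strict contractivity.
  obtain ⟨c, hq, hp, hc⟩ := Quantum.exists_polynomial_circuit m n d
    (Quantum.natDegree_reflectionPoly_le (1 - ε / 2) e M k)
    (fun t ht0 ht4 => Quantum.norm_eval_reflectionPoly_lt (by linarith) (by linarith) he1 M k ht0 ht4)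
    R R'
  have hd1' : (1 : ℝ) ≤ d := by exact_mod_cast hd1
  refine ⟨c, ?_, ?_, ?_⟩
  · have : (Quantum.Circuit.queryCount c : ℝ) ≤ 6 * d + 2 := by exact_mod_cast hq
    nlinarith
  · have h1 : (Quantum.Circuit.primitiveCount c : ℝ) ≤ (3 * d + 1) * (240 * (m + 1)) := by
      exact_mod_cast hp
    calc (Quantum.Circuit.primitiveCount c : ℝ) ≤ (3 * d + 1) * (240 * (m + 1)) := h1
      _ ≤ (4 * d) * (240 * (m + 1)) := by gcongr; linarith
      _ = 960 * (m + 1) * d := by ring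
      _ ≤ 960 * (m + 1) *
          (8 * (1 + 3 / Real.log (1 / ε₀)) * (α / gap) * Real.log (1 / ε)) := by gcongr
      _ = _ := by ring
  · intro H U hH hU hlam
    refine ⟨Quantum.Circuit.eval_mem_unitaryGroup hU.1 c, ?_⟩
    have hlamα := hU.abs_le_of_hasEigenvalue hα hlam.1
    have hβ : 0 < α + |lam| := by positivity
    -- The circuit is fixed before H is known, so it uses α + |λ| and makes sense for every real λ.
    -- Once λ is an eigenvalue, |λ| ≤ α gives β ≤ 2α.
    set β := α + |lam| with hβdef
    set A : Quantum.QubitOp (Fin n) :=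
      ((-lam / β : ℝ) : ℂ) • (1 : Quantum.QubitOp (Fin n)) + ((1 / β : ℝ) : ℂ) • H with hA
    have hAH : A.IsHermitian := by
      refine Matrix.IsHermitian.add ?_ ?_
      · rw [Matrix.IsHermitian, Matrix.conjTranspose_smul, Matrix.conjTranspose_one]
        simp
      · rw [Matrix.IsHermitian, Matrix.conjTranspose_smul, hH.eq]
        simp
    have hAU : A = (R'.1 0 0 * R.1 0 0) • (1 : Quantum.QubitOp (Fin n)) +
        (R'.1 0 1 * R.1 1 0) • Quantum.ancillaBlock U := by
      rw [hA, hR1, hR2, hU.eq_smul, smul_smul, ← Complex.ofReal_mul]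
      congr 3
      ring
    rw [hc U hU.1 A hAH hAU, Complex.ofReal_one, one_smul]
    have heig : ∀ i, ((4 : ℂ) • (A * A)).mulVec ⇑(hH.eigenvectorBasis i) =
        ((4 * ((hH.eigenvalues i - lam) / β) ^ 2 : ℝ) : ℂ) • ⇑(hH.eigenvectorBasis i) := by
      intro i
      have h1 : A.mulVec ⇑(hH.eigenvectorBasis i) =
          (((hH.eigenvalues i - lam) / β : ℝ) : ℂ) • ⇑(hH.eigenvectorBasis i) := by
        rw [hA, Matrix.add_mulVec, Matrix.smul_mulVec, Matrix.smul_mulVec, Matrix.one_mulVec,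
          hH.mulVec_eigenvectorBasis, ← Complex.coe_smul (hH.eigenvalues i), smul_smul, ← add_smul]
        congr 1
        push_cast
        ring
      rw [Matrix.smul_mulVec, ← Matrix.mulVec_mulVec, h1, Matrix.mulVec_smul, h1, smul_smul,
        smul_smul]
      congr 1
      push_cast
      ring
    refine Quantum.opNorm_reflection_sub_le hH lam e _
      (fun i => Quantum.aeval_mulVec_of_eigenvector (heig i) _) hε.le (fun i hi => ?_)
      (fun i hi => ?_)
    -- At λ the filter is exactly 1, so the only error is ε/2 from the scaling.
    · rw [hi, Quantum.eval_reflectionPoly]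
      simp only [sub_self, zero_div, ne_eq, OfNat.ofNat_ne_zero, not_false_eq_true, zero_pow,
        mul_zero, Quantum.eval_filterPoly_zero]
      have : (1 : ℂ) - ((1 - ε / 2 : ℝ) : ℂ) * (e + (1 - e) * ((1 : ℝ) : ℂ)) = ((ε / 2 : ℝ) : ℂ) := by
        push_cast; ring
      rw [this, Complex.norm_real, Real.norm_of_nonneg (by linarith)]
      linarith
    · have hx1 : |(hH.eigenvalues i - lam) / β| ≤ 1 := by
        rw [abs_div, abs_of_pos hβ, div_le_one hβ]
        have h2 := hU.abs_eigenvalues_le hα hH i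
        linarith [abs_sub (hH.eigenvalues i) lam]
      -- This holds because M ≥ 2α/gap, |μ - λ| ≥ gap and β ≤ 2α, so already 2M|μ - λ|/β ≥ 4α/β ≥ 2.
      have hx2 : 2 ≤ (2 * (M : ℝ) + 1) * |(hH.eigenvalues i - lam) / β| := by
        have h1 := hlam.gap_le hH hi
        rw [abs_div, abs_of_pos hβ, ← mul_div_assoc, le_div_iff₀ hβ]
        rw [div_le_iff₀ hgap] at hMle
        have hM0 : (0 : ℝ) ≤ M := Nat.cast_nonneg M
        nlinarith [mul_le_mul_of_nonneg_left h1 hM0]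
      -- The errors add up to ε/2 from the scaling and 2 · ε/4 from the filter.
      refine (Quantum.norm_sub_eval_reflectionPoly_le (by linarith) (by linarith) he1 M k hx1
        hx2).trans ?_
      linarith
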